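/- Notation. For a (finite or infinite) tuple $\underline T=(T_i)_{i\in I}$ of bounded operators on a complex Hilbert space $\mathcal H$ with $\sum_i T_iT_i^*\le \mathbf 1$ (a row contraction, also regarded as an operator $\bigoplus_{i}\mathcal H\to\mathcal H$), let $D_T=(\mathbf 1-\underline T^*\underline T)^{1/2}$ on $\bigoplus_i\mathcal H$, and let $\mathcal D_T$ be the closure of its range. Let $\Gamma$ be the full Fock space over $\ell^2(I)$ with its orthonormal basis $e_\alpha$ indexed by the words $\alpha$ over $I$, with vacuum vector $e_0$ and left creation operators $L_i$. The minimal isometric dilation of $\underline T$ is the tuple $V_i^T(h\oplus f)=T_ih\oplus[e_0\otimes D_T(0,\dots,h,\dots,0)+(L_i\otimes\mathbf 1)f]$ ($h$ at the $i$-th place) on $\mathcal H\oplus(\Gamma\otimes\mathcal D_T)$. The tuple $\underline T$ is coisometric if $\sum_iT_iT_i^*=\mathbf 1$, and ergodic if the only fixed points of $x\mapsto\sum_i T_ixT_i^*$ in $B(\mathcal H)$ are the scalar multiples of $\mathbf 1$; infinite sums converge in the strong operator topology. (1) Let $\underline\omega=(\omega_i)_{i\in I}$ be complex numbers with $\sum_i|\omega_i|^2=1$,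 regarded also as a row contraction on $\mathbb C$. Let $\underline A$ and $\underline B$ be ergodic coisometric row contractions indexed by $I$ on Hilbert spaces $\mathcal H_A$, $\mathcal H_B$ with unit vectors $\Omega_A,\Omega_B$ such that $A_i^*\Omega_A=\bar\omega_i\Omega_A$ and $B_i^*\Omega_B=\bar\omega_i\Omega_B$ for all $i$. Then there is exactly one unitary $W_A:\mathcal H_A\oplus(\Gamma\otimes\mathcal D_A)\to\mathbb C\oplus(\Gamma\otimes\mathcal D_\omega)$ with $W_AV^A_i=V^\omega_iW_A$ for all $i$ and $W_A\Omega_A=1\in\mathbb C$. It maps $\Gamma\otimes\mathcal D_A$ into $\Gamma\otimes\mathcal D_\omega$, and its restriction $M_A$ to $\Gamma\otimes\mathcal D_A$ is a multi-analytic inner operator, i.e. an isometry with $M_A(L_i\otimes\mathbf 1)=(L_i\otimes\mathbf 1)M_A$ for all $i$. The same holds for $\underline B$. Let the extended characteristic functions be the symbols $\hat\theta_A=W_A|_{e_0\otimes\mathcal D_A}:\mathcal D_A\to\Gamma\otimes\mathcal D_\omega$ and $\hat\theta_B$ likewise. Then $\hat\theta_A$ and $\hat\theta_B$ are equivalent,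 i.e. $\hat\theta_A=\hat\theta_BV$ for some unitary $V:\mathcal D_A\to\mathcal D_B$, if and only if $\underline A$ and $\underline B$ are unitarily equivalent, i.e. $UA_i=B_iU$ for all $i$ and some unitary $U:\mathcal H_A\to\mathcal H_B$. (2) Let $Z_1,Z_2$ be normal, unital, ergodic (fixed points are scalar), completely positive maps on $B(\mathcal H_1)$, $B(\mathcal H_2)$ with invariant vector states $\langle\Omega_1,\cdot\,\Omega_1\rangle$ and $\langle\Omega_2,\cdot\,\Omega_2\rangle$, where $\Omega_1,\Omega_2$ are unit vectors. A minimal Kraus decomposition of $Z_j$ is a tuple $\underline A$ with $Z_j(x)=\sum_iA_ixA_i^*$ that is linearly independent (with respect to $\ell^2$ coefficients, if infinite). Then $Z_1$ and $Z_2$ are conjugate, i.e. $Z_1(x)=U^*Z_2(UxU^*)U$ for all $x\in B(\mathcal H_1)$ and some unitary $U:\mathcal H_1\to\mathcal H_2$, if and only if they have minimal Kraus decompositions $\underline A$ of $Z_1$ and $\underline B$ of $Z_2$ with a common tuple $\underline\omega$ as in (1) (that is, $A_i^*\Omega_1=\bar\omega_i\Omega_1$, $B_i^*\Omega_2=\bar\omega_i\Omega_2$,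 $\sum_i|\omega_i|^2=1$) for which $\hat\theta_A$ and $\hat\theta_B$ are equivalent. Moreover $\underline A$ can be prescribed: every minimal Kraus decomposition $\underline A$ of $Z_1$ satisfies $A_i^*\Omega_1=\bar\omega_i\Omega_1$ for some $\underline\omega$ with $\sum_i|\omega_i|^2=1$, and $Z_1$ and $Z_2$ are conjugate if and only if there is a minimal Kraus decomposition $\underline B$ of $Z_2$ with $B_i^*\Omega_2=\bar\omega_i\Omega_2$ for all $i$ such that $\hat\theta_A$ and $\hat\theta_B$ are equivalent. -/

import Mathlib

open scoped CStarAlgebra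

universe u v w

/-- A row contraction `T = (T_i)_{i ∈ ι}` on a Hilbert space `H`, i.e. `∑ T_i T_i^* ≤ 1`.  For an
infinite family this means that all finite partial sums are `≤ 1` in the Loewner order. -/
structure RowContraction (ι : Type w) (H : Type u) [NormedAddCommGroup H] [InnerProductSpace ℂ H]
    [CompleteSpace H] where
  /-- The components of the tuple. -/
  op : ι → H →L[ℂ] H
  sum_le_one : ∀ s : Finset ι, ∑ i ∈ s, op i ∘L ContinuousLinearMap.adjoint (op i) ≤ 1

/-- The Hilbert space `Γ(ℂ^ι) ⊗ 𝓓`, where `Γ(ℂ^ι)` is the full Fock space with its orthonormal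
basis `e_α` indexed by the words `α` in the alphabet `ι`: the element `∑_α e_α ⊗ d_α` is the
square summable family `(d_α)_α`.  The empty word corresponds to the vacuum vector `e_0`. -/
abbrev FockTensor (ι : Type w) (D : Type u) [NormedAddCommGroup D] : Type (max u w) :=
  lp (fun _ : List ι => D) 2

namespace FockTensor

section CreationFun

variable {ι : Type w} {D : Type u} [NormedAddCommGroup D]

open Classical in
/-- The coefficients of `e_i ⊗ f`: the coefficient at the word `iβ` is `f β`, and the coefficient
at all other words is `0`. -/
noncomputable def creationFun (i : ι) (f : List ι → D) : List ι → D
  | [] => 0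
  | j :: β => if j = i then f β else 0

theorem creationFun_cons (i : ι) (f : List ι → D) (β : List ι) :
    creationFun i f (i :: β) = f β := by
  simp [creationFun]

theorem creationFun_eq_zero (i : ι) (f : List ι → D) (α : List ι)
    (h : α ∉ Set.range (List.cons i)) : creationFun i f α = 0 := by
  cases α with
  | nil => rfl
  | cons j β =>
    by_cases hj : j = i
    · exact absurd ⟨β, by rw [hj]⟩ h
    · simp [creationFun, hj]

end CreationFun

variable {ι : Type w} {D : Type u} [NormedAddCommGroup D] [InnerProductSpace ℂ D]

open Classical in
/-- The embedding `d ↦ e_0 ⊗ d`. -/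
noncomputable def vacuum : D →L[ℂ] FockTensor ι D :=
  lp.singleContinuousLinearMap ℂ (fun _ : List ι => D) 2 []

open Classical in
/-- The left creation operator `L_i ⊗ 1`, `e_α ⊗ d ↦ e_{iα} ⊗ d`. -/
noncomputable def creation (i : ι) : FockTensor ι D →ₗᵢ[ℂ] FockTensor ι D where
  toFun f := ⟨creationFun i f, by
    refine memℓp_gen ?_
    refine (Function.Injective.summable_iff (g := List.cons i) (List.cons_injective)
      (fun α hα => ?_)).1 ?_
    · simp [creationFun_eq_zero i _ α hα]
    · simpa [Function.comp_def, creationFun_cons] using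
        (lp.memℓp f).summable (by norm_num)⟩
  map_add' f g := by
    ext α
    cases α with
    | nil => change (0 : D) = 0 + 0; simp
    | cons j β =>
      change (if j = i then f β + g β else 0) = (if j = i then f β else 0) + if j = i then g β else 0
      split_ifs <;> simp
  map_smul' c f := by
    ext α
    cases α with
    | nil => change (0 : D) = c • (0 : D); simp
    | cons j β =>
      change (if j = i then c • f β else 0) = c • if j = i then f β else 0
      split_ifs <;> simp
  norm_map' f := by
    have h2 : 0 < (2 : ENNReal).toReal := by norm_num
    rw [lp.norm_eq_tsum_rpow h2, lp.norm_eq_tsum_rpow h2]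
    congr 1
    have := Function.Injective.tsum_eq (g := List.cons i) (List.cons_injective)
      (f := fun α => ‖creationFun i f α‖ ^ (2 : ENNReal).toReal) (by
        intro α hα
        by_contra hn
        apply hα
        simp [creationFun_eq_zero i _ α hn])
    simpa [creationFun_cons] using this.symm

/-- A multi-analytic inner operator `M : Γ ⊗ D → Γ ⊗ E`: an isometry with
`M (L_i ⊗ 1) = (L_i ⊗ 1) M` for all `i`. -/
def IsMultiAnalyticInner {E : Type v} [NormedAddCommGroup E] [InnerProductSpace ℂ E]
    (M : FockTensor ι D →L[ℂ] FockTensor ι E) : Prop :=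
  (∀ x, ‖M x‖ = ‖x‖) ∧ ∀ i x, M (creation i x) = creation i (M x)

end FockTensor

/-- The square root of a positive operator on a Hilbert space. -/
noncomputable def operatorSqrt {H : Type u} [NormedAddCommGroup H] [InnerProductSpace ℂ H]
    [CompleteSpace H] (T : H →L[ℂ] H) : H →L[ℂ] H :=
  CFC.sqrt T

namespace RowContraction

section Dilation

variable {ι : Type w} {H : Type u} [NormedAddCommGroup H] [InnerProductSpace ℂ H] [CompleteSpace H]

theorem sum_norm_sq_le (T : RowContraction ι H) (s : Finset ι) (h : H) :
    ∑ i ∈ s, ‖ContinuousLinearMap.adjoint (T.op i) h‖ ^ 2 ≤ ‖h‖ ^ 2 := by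
  have h1 := (ContinuousLinearMap.le_def _ _).1 (T.sum_le_one s)
  have h2 := h1.re_inner_nonneg_right h
  have h3 : ∀ i, RCLike.re (inner ℂ h (T.op i (ContinuousLinearMap.adjoint (T.op i) h))) =
      ‖ContinuousLinearMap.adjoint (T.op i) h‖ ^ 2 := by
    intro i
    rw [← ContinuousLinearMap.adjoint_inner_left, inner_self_eq_norm_sq]
  simp only [sub_apply, one_apply_eq_self, inner_sub_right,
    sum_apply, ContinuousLinearMap.comp_apply, inner_sum, map_sub, map_sum, h3,
    inner_self_eq_norm_sq] at h2
  linarith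

theorem memℓp_column (T : RowContraction ι H) (h : H) :
    Memℓp (fun i => ContinuousLinearMap.adjoint (T.op i) h) 2 := by
  refine memℓp_gen' (C := ‖h‖ ^ 2) fun s => ?_
  simpa using T.sum_norm_sq_le s h

/-- The column operator `T^* : H → ⨁_i H`, `h ↦ (T_i^* h)_i`. -/
noncomputable def column (T : RowContraction ι H) : H →L[ℂ] lp (fun _ : ι => H) 2 :=
  LinearMap.mkContinuous
    { toFun := fun h => ⟨fun i => ContinuousLinearMap.adjoint (T.op i) h, T.memℓp_column h⟩
      map_add' := fun x y => by
        ext i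
        exact map_add (ContinuousLinearMap.adjoint (T.op i)) x y
      map_smul' := fun c x => by
        ext i
        exact map_smul (ContinuousLinearMap.adjoint (T.op i)) c x } 1 (fun h => by
        have h2 : 0 < (2 : ENNReal).toReal := by norm_num
        rw [one_mul]
        refine lp.norm_le_of_forall_sum_le h2 (norm_nonneg _) fun s => ?_
        simpa using T.sum_norm_sq_le s h)

/-- The row operator `T = (T_i)_i : ⨁_i H → H`, `(h_i)_i ↦ ∑ T_i h_i`. -/
noncomputable def row (T : RowContraction ι H) : lp (fun _ : ι => H) 2 →L[ℂ] H :=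
  ContinuousLinearMap.adjoint T.column

open Classical in
/-- The row operator restricts to `T_i` on the `i`-th summand. -/
theorem row_single (T : RowContraction ι H) (i : ι) (h : H) :
    T.row (lp.single 2 i h) = T.op i h := by
  refine ext_inner_right ℂ fun k => ?_
  rw [row, ContinuousLinearMap.adjoint_inner_left, lp.inner_single_left]
  exact ContinuousLinearMap.adjoint_inner_right _ _ _

/-- The defect operator `D = (1 - T^* T)^{1/2}` on `⨁_i H`. -/
noncomputable def defectOp (T : RowContraction ι H) :
    lp (fun _ : ι => H) 2 →L[ℂ] lp (fun _ : ι => H) 2 :=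
  operatorSqrt (1 - ContinuousLinearMap.adjoint T.row ∘L T.row)

/-- The defect space `𝓓`, the closed range of `D`. -/
noncomputable def defectSpace (T : RowContraction ι H) : Submodule ℂ (lp (fun _ : ι => H) 2) :=
  (LinearMap.range (T.defectOp : lp (fun _ : ι => H) 2 →ₗ[ℂ] lp (fun _ : ι => H) 2)).topologicalClosure

open Classical in
/-- `D_i h = D (0, …, 0, h, 0, …, 0)` with `h` at the `i`-th place, as an operator `H → 𝓓`. -/
noncomputable def defectComponent (T : RowContraction ι H) (i : ι) : H →L[ℂ] T.defectSpace :=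
  (T.defectOp ∘L lp.singleContinuousLinearMap ℂ (fun _ : ι => H) 2 i).codRestrict T.defectSpace
    (fun _ => Submodule.le_topologicalClosure _ (LinearMap.mem_range_self _ _))

/-- The space `H ⊕ (Γ(ℂ^ι) ⊗ 𝓓)` of the minimal isometric dilation. -/
abbrev DilationSpace (T : RowContraction ι H) : Type (max u w) :=
  WithLp 2 (H × FockTensor ι T.defectSpace)

/-- Popescu's minimal isometric dilation `V` of `T` on `H ⊕ (Γ(ℂ^ι) ⊗ 𝓓)`:
`V_i (h ⊕ f) = T_i h ⊕ (e_0 ⊗ D_i h + (L_i ⊗ 1) f)`. -/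
noncomputable def dilation (T : RowContraction ι H) (i : ι) :
    T.DilationSpace →L[ℂ] T.DilationSpace :=
  ((WithLp.prodContinuousLinearEquiv 2 ℂ H (FockTensor ι T.defectSpace)).symm :
      H × FockTensor ι T.defectSpace →L[ℂ] T.DilationSpace) ∘L
    ((T.op i ∘L WithLp.fstL 2 ℂ H (FockTensor ι T.defectSpace)).prod
      (FockTensor.vacuum ∘L T.defectComponent i ∘L WithLp.fstL 2 ℂ H (FockTensor ι T.defectSpace) +
        (FockTensor.creation i).toContinuousLinearMap ∘L
          WithLp.sndL 2 ℂ H (FockTensor ι T.defectSpace)))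

theorem dilation_apply (T : RowContraction ι H) (i : ι) (h : H)
    (f : FockTensor ι T.defectSpace) :
    T.dilation i (WithLp.toLp 2 (h, f)) =
      WithLp.toLp 2 (T.op i h,
        FockTensor.vacuum (T.defectComponent i h) + FockTensor.creation i f) :=
  rfl

end Dilation

/-- A tuple `ω` of complex numbers with `∑ |ω_i|^2 = 1`, as a row contraction on `ℂ`. -/
noncomputable def scalar {ι : Type w} (ω : ι → ℂ) (hω : HasSum (fun i => ‖ω i‖ ^ 2) 1) :
    RowContraction ι ℂ where
  op i := ω i • ContinuousLinearMap.id ℂ ℂ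
  sum_le_one s := by
    have h1 : ∑ i ∈ s, ‖ω i‖ ^ 2 ≤ 1 := sum_le_hasSum s (fun i _ => sq_nonneg _) hω
    have h2 : ∑ i ∈ s, (ω i • ContinuousLinearMap.id ℂ ℂ) ∘L
        ContinuousLinearMap.adjoint (ω i • ContinuousLinearMap.id ℂ ℂ) =
        ((∑ i ∈ s, ‖ω i‖ ^ 2 : ℝ) : ℂ) • (1 : ℂ →L[ℂ] ℂ) := by
      have h4 : ∀ i, ContinuousLinearMap.adjoint (ω i • ContinuousLinearMap.id ℂ ℂ) =
          (starRingEnd ℂ) (ω i) • ContinuousLinearMap.id ℂ ℂ := fun i => by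
        rw [map_smulₛₗ]
        exact congrArg _ (star_one (ℂ →L[ℂ] ℂ))
      ext
      simp [h4, Complex.conj_mul']
    rw [h2, ContinuousLinearMap.le_def]
    have h3 : (1 : ℂ →L[ℂ] ℂ) - ((∑ i ∈ s, ‖ω i‖ ^ 2 : ℝ) : ℂ) • (1 : ℂ →L[ℂ] ℂ) =
        ((1 - ∑ i ∈ s, ‖ω i‖ ^ 2 : ℝ) : ℂ) • (1 : ℂ →L[ℂ] ℂ) := by
      rw [Complex.ofReal_sub]
      ext
      simp
    rw [h3]
    refine ContinuousLinearMap.IsPositive.smul_of_nonneg ContinuousLinearMap.isPositive_one ?_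
    exact_mod_cast sub_nonneg.2 h1

section Properties

variable {ι : Type w} {H : Type u} [NormedAddCommGroup H] [InnerProductSpace ℂ H] [CompleteSpace H]

/-- `T` is coisometric: `∑ T_i T_i^* = 1` (in the strong operator topology). -/
def IsCoisometric (T : RowContraction ι H) : Prop :=
  ∀ h, HasSum (fun i => T.op i (ContinuousLinearMap.adjoint (T.op i) h)) h

/-- `T` is ergodic: the fixed points of `x ↦ ∑ T_i x T_i^*` (a sum in the strong operator
topology) are the multiples of the identity. -/
def IsErgodic (T : RowContraction ι H) : Prop :=
  ∀ x : H →L[ℂ] H,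
    (∀ h, HasSum (fun i => T.op i (x (ContinuousLinearMap.adjoint (T.op i) h))) (x h)) →
      ∃ c : ℂ, x = c • (1 : H →L[ℂ] H)

/-- `Ω` is a common eigenvector of the adjoints, `T_i^* Ω = \bar ω_i Ω` for all `i`. -/
def HasAdjointEigenvector (T : RowContraction ι H) (Ω : H) (ω : ι → ℂ) : Prop :=
  ∀ i, ContinuousLinearMap.adjoint (T.op i) Ω = (starRingEnd ℂ) (ω i) • Ω

/-- `T` and `S` are unitarily equivalent: `U T_i = S_i U` for all `i` and some unitary `U`. -/
def UnitarilyEquivalent {K : Type v} [NormedAddCommGroup K] [InnerProductSpace ℂ K]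
    [CompleteSpace K] (T : RowContraction ι H) (S : RowContraction ι K) : Prop :=
  ∃ U : H ≃ₗᵢ[ℂ] K, ∀ i h, U (T.op i h) = S.op i (U h)

/-- `W` is a unitary intertwiner between the minimal isometric dilations of `A` and of `ω`, with
the normalization `W Ω = 1 ∈ ℂ`. -/
def IsIntertwiner (A : RowContraction ι H) (Ω : H) (ω : ι → ℂ)
    (hω : HasSum (fun i => ‖ω i‖ ^ 2) 1)
    (W : A.DilationSpace ≃ₗᵢ[ℂ] (scalar ω hω).DilationSpace) : Prop :=
  (∀ i x, W (A.dilation i x) = (scalar ω hω).dilation i (W x)) ∧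
    W (WithLp.toLp 2 (Ω, 0)) = WithLp.toLp 2 (1, 0)

open Classical in
/-- The multi-analytic operator `M_Θ̂ : Γ ⊗ 𝓓_A → Γ ⊗ 𝓓_ω` of `A`: the restriction of the
intertwiner `W` to `Γ ⊗ 𝓓_A`, with values in `Γ ⊗ 𝓓_ω`.  (The value is `0` if there is no
intertwiner.) -/
noncomputable def extCharOp (A : RowContraction ι H) (Ω : H) (ω : ι → ℂ)
    (hω : HasSum (fun i => ‖ω i‖ ^ 2) 1) :
    FockTensor ι A.defectSpace →L[ℂ] FockTensor ι (scalar ω hω).defectSpace :=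
  if h : ∃ W, IsIntertwiner A Ω ω hω W then
    WithLp.sndL 2 ℂ ℂ (FockTensor ι (scalar ω hω).defectSpace) ∘L
      (h.choose.toContinuousLinearEquiv :
        A.DilationSpace →L[ℂ] (scalar ω hω).DilationSpace) ∘L
      ((WithLp.prodContinuousLinearEquiv 2 ℂ H (FockTensor ι A.defectSpace)).symm :
        H × FockTensor ι A.defectSpace →L[ℂ] A.DilationSpace) ∘L
      ContinuousLinearMap.inr ℂ H (FockTensor ι A.defectSpace)
  else 0

/-- The extended characteristic function `θ̂_A : 𝓓_A → Γ ⊗ 𝓓_ω`, the symbol of `M_Θ̂`, i.e. its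
restriction to `e_0 ⊗ 𝓓_A ≃ 𝓓_A`. -/
noncomputable def extChar (A : RowContraction ι H) (Ω : H) (ω : ι → ℂ)
    (hω : HasSum (fun i => ‖ω i‖ ^ 2) 1) :
    A.defectSpace →L[ℂ] FockTensor ι (scalar ω hω).defectSpace :=
  A.extCharOp Ω ω hω ∘L FockTensor.vacuum

/-- The extended characteristic function is well defined: there is exactly one normalized
intertwiner `W`, it maps `Γ ⊗ 𝓓_A` into `Γ ⊗ 𝓓_ω`, acting there as `M_Θ̂`, and `M_Θ̂` is a
multi-analytic inner operator. -/
def HasExtChar (A : RowContraction ι H) (Ω : H) (ω : ι → ℂ)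
    (hω : HasSum (fun i => ‖ω i‖ ^ 2) 1) : Prop :=
  (∃ W, IsIntertwiner A Ω ω hω W ∧ (∀ W', IsIntertwiner A Ω ω hω W' → W' = W) ∧
    ∀ f, W (WithLp.toLp 2 (0, f)) = WithLp.toLp 2 (0, A.extCharOp Ω ω hω f)) ∧
  FockTensor.IsMultiAnalyticInner (A.extCharOp Ω ω hω)

/-- `θ̂_A` and `θ̂_B` are equivalent: `θ̂_A = θ̂_B V` for a unitary `V : 𝓓_A → 𝓓_B`. -/
def ExtCharEquivalent {K : Type v} [NormedAddCommGroup K] [InnerProductSpace ℂ K]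
    [CompleteSpace K] (A : RowContraction ι H) (ΩA : H) (B : RowContraction ι K) (ΩB : K)
    (ω : ι → ℂ) (hω : HasSum (fun i => ‖ω i‖ ^ 2) 1) : Prop :=
  ∃ V : A.defectSpace ≃ₗᵢ[ℂ] B.defectSpace, ∀ d, A.extChar ΩA ω hω d = B.extChar ΩB ω hω (V d)

/-- `A` is a minimal Kraus decomposition of `Z`: `Z x = ∑ A_i x A_i^*` (in the strong operator
topology), and the `A_i` are linearly independent (for infinite families, with respect to square
summable coefficients). -/
def IsMinimalKraus (A : RowContraction ι H) (Z : (H →L[ℂ] H) →CP (H →L[ℂ] H)) : Prop :=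
  (∀ x h, HasSum (fun i => A.op i (x (ContinuousLinearMap.adjoint (A.op i) h))) (Z x h)) ∧
    ∀ c : lp (fun _ : ι => ℂ) 2, (∀ h, HasSum (fun i => c i • A.op i h) 0) → c = 0

end Properties

end RowContraction

namespace CPMap

variable {H : Type u} [NormedAddCommGroup H] [InnerProductSpace ℂ H] [CompleteSpace H]

/-- A normal, unital, ergodic completely positive map on `B(H)` for which the vector state of `Ω`
is invariant.  Normality is the preservation of least upper bounds of (bounded) directed sets. -/
structure IsNormalUnitalErgodic (Z : (H →L[ℂ] H) →CP (H →L[ℂ] H)) (Ω : H) : Prop where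
  normal : ScottContinuous Z
  unital : Z 1 = 1
  ergodic : ∀ x, Z x = x → ∃ c : ℂ, x = c • (1 : H →L[ℂ] H)
  invariant : ∀ x, inner ℂ Ω (Z x Ω) = inner ℂ Ω (x Ω)

variable {K : Type v} [NormedAddCommGroup K] [InnerProductSpace ℂ K] [CompleteSpace K]

/-- `Z₁` and `Z₂` are conjugate: `Z₁ x = U^* Z₂ (U x U^*) U` for some unitary `U`. -/
def Conjugate (Z₁ : (H →L[ℂ] H) →CP (H →L[ℂ] H)) (Z₂ : (K →L[ℂ] K) →CP (K →L[ℂ] K)) : Prop :=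
  ∃ U : H ≃ₗᵢ[ℂ] K, ∀ x : H →L[ℂ] H,
    Z₁ x = (U.symm : K →L[ℂ] H) ∘L
      Z₂ ((U : H →L[ℂ] K) ∘L x ∘L (U.symm : K →L[ℂ] H)) ∘L (U : H →L[ℂ] K)

/-- The extended characteristic functions of `Z₁` and `Z₂`, which are those of minimal Kraus
decompositions with a common eigenvalue tuple, are equivalent. -/
def ExtCharEquivalent (Z₁ : (H →L[ℂ] H) →CP (H →L[ℂ] H)) (Ω₁ : H)
    (Z₂ : (K →L[ℂ] K) →CP (K →L[ℂ] K)) (Ω₂ : K) : Prop :=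
  ∃ (ι : Type u) (ω : ι → ℂ) (hω : HasSum (fun i => ‖ω i‖ ^ 2) 1)
    (A : RowContraction ι H) (B : RowContraction ι K),
    A.IsMinimalKraus Z₁ ∧ B.IsMinimalKraus Z₂ ∧
      A.HasAdjointEigenvector Ω₁ ω ∧ B.HasAdjointEigenvector Ω₂ ω ∧
      A.ExtCharEquivalent Ω₁ B Ω₂ ω hω

end CPMap

/-!
Write `V` for the minimal isometric dilation of a row contraction `T` on `H`. Two facts about it
carry the classification of tuples. It is minimal: `H` is cyclic for `V`
(`RowContraction.eq_top_of_dilation_mem`). Therefore every isometry `j : H → K` with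
`j A_i^* = B_i^* j` lifts to an isometry of the dilation spaces which intertwines the dilations
(`RowContraction.exists_lift`), because the Gram matrices of the vectors `V_α h` and `V_α (j h)`
agree. And if `T` is coisometric, then the compression to `H` of an operator commuting with `V` is a
fixed point of `x ↦ ∑ T_i x T_i^*`, so it is a scalar when `T` is ergodic
(`RowContraction.IsErgodic.exists_compression_eq`).

A common eigenvector `Ω` of the `T_i^*` is an isometry `ℂ → H` of the required kind. The projection
onto the range of its lift commutes with `V` and fixes `Ω`, so it compresses to `1`, and the range
contains `H` and is everything: this is the adjoint of the intertwiner `W`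
(`RowContraction.HasAdjointEigenvector.exists_equiv`). Its uniqueness is minimality for `ω`.

If `θ̂_A = θ̂_B V`, then `W_B^* W_A` maps `Γ ⊗ 𝓓_A` onto `Γ ⊗ 𝓓_B`, hence `H_A` onto `H_B`, and
restricts to a unitary equivalence. Conversely a unitary equivalence, corrected by a phase so that
it maps `Ω_A` to `Ω_B`, has `W_B^* W_A` as its lift, and this maps `e_0 ⊗ 𝓓_A` onto `e_0 ⊗ 𝓓_B`
(`RowContraction.extCharEquivalent_iff`).

For completely positive maps, invariance of the vector state of `Ω` makes `Ω` a common eigenvector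
of the adjoints of the Kraus operators, and a conjugacy transports a Kraus tuple of `Z₁` to one of
`Z₂` with the same eigenvalues, since an ergodic coisometric tuple has only one tuple of
eigenvalues (`RowContraction.HasAdjointEigenvector.unique`). It remains to find a minimal Kraus
decomposition (`CPMap.exists_isMinimalKraus`). Complete positivity says that `(x, y) ↦ Z(|x⟩⟨y|)` is
a positive semidefinite operator-valued kernel on `H`. The elements of its reproducing kernel
Hilbert space are operators on `H`, and those of an orthonormal basis form a Kraus decomposition on
the finite rank operators. Normality along the finite rank projections increasing to `1` extends
it to all operators.
-/

open ContinuousLinearMap (adjoint)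

/-! ### Isometries of Hilbert spaces -/

/-- A total family of vectors of `E` can be mapped isometrically onto every family in a complete
space with the same Gram matrix. -/
theorem exists_linearIsometry_of_inner_eq {X : Type*} {E F : Type*}
    [NormedAddCommGroup E] [InnerProductSpace ℂ E]
    [NormedAddCommGroup F] [InnerProductSpace ℂ F] [CompleteSpace F]
    (x : X → E) (y : X → F) (hxy : ∀ a b, inner ℂ (x a) (x b) = inner ℂ (y a) (y b))
    (hx : (Submodule.span ℂ (Set.range x)).topologicalClosure = ⊤) :
    ∃ J : E →ₗᵢ[ℂ] F, ∀ a, J (x a) = y a := by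
  set e : (X →₀ ℂ) →ₗ[ℂ] E := Finsupp.linearCombination ℂ x with he
  set f : (X →₀ ℂ) →ₗ[ℂ] F := Finsupp.linearCombination ℂ y with hf
  have hinner : ∀ c, inner ℂ (f c) (f c) = inner ℂ (e c) (e c) := by
    intro c
    simp only [he, hf, Finsupp.linearCombination_apply, Finsupp.sum_inner, Finsupp.inner_sum, hxy,
      inner_smul_left, inner_smul_right]
  have hnorm : ∀ c, ‖f c‖ = ‖e c‖ := by
    intro c
    have h := hinner c
    rw [inner_self_eq_norm_sq_to_K, inner_self_eq_norm_sq_to_K] at h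
    have h' : ‖f c‖ ^ 2 = ‖e c‖ ^ 2 := by exact_mod_cast h
    exact (sq_eq_sq₀ (norm_nonneg _) (norm_nonneg _)).1 h'
  have hdense : DenseRange e := by
    have h1 : (LinearMap.range e).topologicalClosure = ⊤ := by
      rw [he, Finsupp.range_linearCombination, hx]
    exact Submodule.dense_iff_topologicalClosure_eq_top.2 h1
  have hbd : ∀ c, ‖f c‖ ≤ 1 * ‖e c‖ := fun c => by rw [one_mul, hnorm]
  set J : E →L[ℂ] F := f.extendOfNorm e
  have hJ : ∀ c, J (e c) = f c := LinearMap.extendOfNorm_eq hdense ⟨1, hbd⟩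
  refine ⟨⟨J.toLinearMap, fun z => ?_⟩, fun a => ?_⟩
  · refine hdense.induction_on (p := fun z => ‖J z‖ = ‖z‖) z
      (isClosed_eq J.continuous.norm continuous_norm) fun c => ?_
    rw [hJ, hnorm]
  · have h := hJ (Finsupp.single a 1)
    simpa [he, hf] using h

theorem exists_smul_linearIsometryEquiv {H K : Type*} [NormedAddCommGroup H]
    [InnerProductSpace ℂ H] [NormedAddCommGroup K] [InnerProductSpace ℂ K] (U : H ≃ₗᵢ[ℂ] K) {c : ℂ}
    (hc : ‖c‖ = 1) : ∃ U' : H ≃ₗᵢ[ℂ] K, ∀ h, U' h = c • U h := by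
  have hc0 : c ≠ 0 := fun h => by simp [h] at hc
  refine ⟨⟨U.toLinearEquiv.trans (LinearEquiv.smulOfNeZero ℂ K c hc0), fun h => ?_⟩, fun h => rfl⟩
  change ‖c • U h‖ = ‖h‖
  rw [norm_smul, hc, one_mul, U.norm_map]

theorem norm_adjoint_linearIsometry_apply_le {E F : Type*}
    [NormedAddCommGroup E] [InnerProductSpace ℂ E] [CompleteSpace E]
    [NormedAddCommGroup F] [InnerProductSpace ℂ F] [CompleteSpace F] (J : E →ₗᵢ[ℂ] F) (y : F) :
    ‖adjoint J.toContinuousLinearMap y‖ ≤ ‖y‖ := by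
  have h1 : ‖adjoint J.toContinuousLinearMap‖ ≤ 1 :=
    (LinearIsometryEquiv.norm_map _ _).trans_le J.norm_toContinuousLinearMap_le
  simpa using ContinuousLinearMap.le_of_opNorm_le _ h1 y

/-! ### The Fock space -/

namespace FockTensor

variable {ι : Type w} {D : Type u} [NormedAddCommGroup D] [InnerProductSpace ℂ D]

open Classical in
theorem vacuum_apply (d : D) (α : List ι) :
    (vacuum d : FockTensor ι D) α = if α = [] then d else 0 := by
  change lp.single (E := fun _ : List ι => D) 2 [] d α = _
  rw [lp.single_apply]
  split_ifs with h
  · subst h; rfl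
  · simp [Pi.single, h]

theorem vacuum_nil (d : D) : (vacuum d : FockTensor ι D) [] = d := by
  rw [vacuum_apply, if_pos rfl]

theorem creation_nil (i : ι) (f : FockTensor ι D) : creation i f [] = 0 := rfl

open Classical in
theorem creation_cons (i j : ι) (f : FockTensor ι D) (β : List ι) :
    creation i f (j :: β) = if j = i then f β else 0 := rfl

theorem inner_vacuum (d : D) (f : FockTensor ι D) :
    inner ℂ (vacuum d) f = inner ℂ d (f []) := by
  classical
  rw [← lp.inner_single_left (𝕜 := ℂ) (G := fun _ : List ι => D) [] d f]
  congr 1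

theorem norm_vacuum (d : D) : ‖(vacuum d : FockTensor ι D)‖ = ‖d‖ := by
  have h : (‖(vacuum d : FockTensor ι D)‖ : ℂ) ^ 2 = (‖d‖ : ℂ) ^ 2 := by
    have h1 := inner_self_eq_norm_sq_to_K (𝕜 := ℂ) (vacuum d : FockTensor ι D)
    have h2 := inner_self_eq_norm_sq_to_K (𝕜 := ℂ) d
    rw [inner_vacuum, vacuum_nil] at h1
    exact h1.symm.trans h2
  have h' : ‖(vacuum d : FockTensor ι D)‖ ^ 2 = ‖d‖ ^ 2 := by exact_mod_cast h
  exact (sq_eq_sq₀ (norm_nonneg _) (norm_nonneg _)).1 h'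

theorem vacuum_injective :
    Function.Injective (vacuum : D →L[ℂ] FockTensor ι D) := fun d e h => by
  rw [← vacuum_nil (ι := ι) d, h, vacuum_nil]

theorem inner_vacuum_creation (d : D) (i : ι) (f : FockTensor ι D) :
    inner ℂ (vacuum d) (creation i f) = 0 := by
  rw [inner_vacuum, creation_nil, inner_zero_right]

open Classical in
theorem inner_creation_creation (i j : ι) (f g : FockTensor ι D) :
    inner ℂ (creation i f) (creation j g) = if i = j then inner ℂ f g else 0 := by
  split_ifs with h
  · subst h
    exact (creation i).inner_map_map f g
  · rw [lp.inner_eq_tsum]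
    refine (tsum_congr fun α => ?_).trans tsum_zero
    cases α with
    | nil => rw [creation_nil, inner_zero_left]
    | cons k β =>
      rw [creation_cons, creation_cons]
      split_ifs with h1 h2
      · exact absurd (h1.symm.trans h2) h
      · rw [inner_zero_right]
      · rw [inner_zero_left]
      · rw [inner_zero_left]

/-- `e_0 ⊗ D` is cyclic for the creation operators. -/
theorem eq_top_of_creation_mem (S : Submodule ℂ (FockTensor ι D))
    (hS : IsClosed (S : Set (FockTensor ι D))) (hv : ∀ d, vacuum d ∈ S)
    (hc : ∀ i, ∀ f ∈ S, creation i f ∈ S) : S = ⊤ := by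
  classical
  have hsingle : ∀ (α : List ι) (d : D),
      (lp.single (E := fun _ : List ι => D) 2 α d : FockTensor ι D) ∈ S := by
    intro α d
    induction α with
    | nil =>
      convert! hv d using 1
    | cons i α ih =>
      convert! hc i _ ih using 1
      ext β
      cases β with
      | nil => rw [creation_nil, lp.single_apply]; simp
      | cons j β =>
        rw [creation_cons, lp.single_apply, lp.single_apply]
        by_cases hj : j = i
        · subst hj
          by_cases hβ : β = α
          · subst hβ; simp
          · simp [Pi.single, hβ]
        · simp [Pi.single, hj]
  refine Submodule.eq_top_iff'.2 fun f => ?_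
  have h := lp.hasSum_single (E := fun _ : List ι => D) (p := 2) (by simp) f
  exact hS.mem_of_tendsto h (Filter.Eventually.of_forall fun s =>
    Submodule.sum_mem _ fun α _ => hsingle α (f α))

end FockTensor

namespace RowContraction

section DilationBasics

variable {ι : Type w} {H : Type u} [NormedAddCommGroup H] [InnerProductSpace ℂ H] [CompleteSpace H]

/-! ### The defect operator -/

theorem column_apply (T : RowContraction ι H) (h : H) (i : ι) :
    T.column h i = adjoint (T.op i) h := rfl

theorem norm_column_le (T : RowContraction ι H) : ‖T.column‖ ≤ 1 :=
  LinearMap.mkContinuous_norm_le _ zero_le_one _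

theorem norm_row_le (T : RowContraction ι H) : ‖T.row‖ ≤ 1 := by
  rw [row]
  exact (LinearIsometryEquiv.norm_map _ _).trans_le T.norm_column_le

theorem one_sub_row_nonneg (T : RowContraction ι H) : 0 ≤ 1 - adjoint T.row ∘L T.row := by
  rw [ContinuousLinearMap.nonneg_iff_isPositive]
  refine (ContinuousLinearMap.isPositive_def' ).2 ⟨?_, fun x => ?_⟩
  · rw [IsSelfAdjoint, star_sub, star_one]
    congr 1
    rw [ContinuousLinearMap.star_eq_adjoint, ContinuousLinearMap.adjoint_comp,
      ContinuousLinearMap.adjoint_adjoint]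
  · rw [ContinuousLinearMap.reApplyInnerSelf_apply]
    simp only [sub_apply, one_apply_eq_self, inner_sub_left, ContinuousLinearMap.comp_apply,
      ContinuousLinearMap.adjoint_inner_left, map_sub, inner_self_eq_norm_sq]
    have h1 : ‖T.row x‖ ≤ ‖x‖ := by
      simpa using T.row.le_of_opNorm_le T.norm_row_le x
    nlinarith [norm_nonneg (T.row x), norm_nonneg x]

theorem inner_defectOp (T : RowContraction ι H) (x y : lp (fun _ : ι => H) 2) :
    inner ℂ (T.defectOp x) (T.defectOp y) = inner ℂ x y - inner ℂ (T.row x) (T.row y) := by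
  have h1 : IsSelfAdjoint T.defectOp := IsSelfAdjoint.of_nonneg (CFC.sqrt_nonneg _)
  have h2 : T.defectOp * T.defectOp = 1 - adjoint T.row ∘L T.row :=
    CFC.sqrt_mul_sqrt_self _ T.one_sub_row_nonneg
  have h3 : adjoint T.defectOp = T.defectOp := h1
  conv_lhs => rw [← ContinuousLinearMap.adjoint_inner_right, h3]
  rw [show T.defectOp (T.defectOp y) = (T.defectOp * T.defectOp) y from rfl, h2]
  simp only [sub_apply, one_apply_eq_self, inner_sub_right, ContinuousLinearMap.comp_apply,
    ContinuousLinearMap.adjoint_inner_right]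

open Classical in
theorem coe_defectComponent (T : RowContraction ι H) (i : ι) (h : H) :
    (T.defectComponent i h : lp (fun _ : ι => H) 2) = T.defectOp (lp.single 2 i h) := rfl

open Classical in
theorem inner_defectComponent (T : RowContraction ι H) (i j : ι) (h k : H) :
    inner ℂ (T.defectComponent i h) (T.defectComponent j k) =
      (if i = j then inner ℂ h k else 0) - inner ℂ (T.op i h) (T.op j k) := by
  rw [Submodule.coe_inner, coe_defectComponent, coe_defectComponent, inner_defectOp,
    row_single, row_single, lp.inner_single_left, lp.single_apply]
  congr 1
  split_ifs with hij
  · subst hij; simp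
  · simp [Pi.single, hij]

/-- The vectors `D_i h` are total in the defect space. -/
theorem eq_top_of_defectComponent_mem (T : RowContraction ι H) (S : Submodule ℂ T.defectSpace)
    (hS : IsClosed (S : Set T.defectSpace)) (hD : ∀ i h, T.defectComponent i h ∈ S) : S = ⊤ := by
  classical
  have hrange : ∀ x, (⟨T.defectOp x, Submodule.le_topologicalClosure _
      (LinearMap.mem_range_self _ _)⟩ : T.defectSpace) ∈ S := by
    intro x
    have h := (lp.hasSum_single (E := fun _ : ι => H) (p := 2) (by simp) x).mapL
      (T.defectOp.codRestrict T.defectSpace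
        (fun _ => Submodule.le_topologicalClosure _ (LinearMap.mem_range_self _ _)))
    exact hS.mem_of_tendsto h (Filter.Eventually.of_forall fun s =>
      Submodule.sum_mem _ fun i _ => hD i (x i))
  refine Submodule.eq_top_iff'.2 fun d => ?_
  have hd : (d : lp (fun _ : ι => H) 2) ∈ closure
      (LinearMap.range (T.defectOp : lp (fun _ : ι => H) 2 →ₗ[ℂ] lp (fun _ : ι => H) 2) :
        Set (lp (fun _ : ι => H) 2)) := d.2
  rw [← SetLike.mem_coe, ← hS.closure_eq, closure_subtype]
  refine closure_mono ?_ hd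
  rintro _ ⟨x, rfl⟩
  exact ⟨_, hrange x, rfl⟩

instance (T : RowContraction ι H) : CompleteSpace T.defectSpace :=
  (Submodule.isClosed_topologicalClosure _).completeSpace_coe

/-! ### The isometric dilation -/

/-- The embedding `H → H ⊕ (Γ ⊗ 𝓓)`. -/
noncomputable def base (T : RowContraction ι H) : H →ₗᵢ[ℂ] T.DilationSpace where
  toFun h := WithLp.toLp 2 (h, 0)
  map_add' h k := by
    rw [← WithLp.toLp_add, Prod.mk_add_mk, add_zero]
  map_smul' c h := by
    rw [RingHom.id_apply, ← WithLp.toLp_smul, Prod.smul_mk, smul_zero]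
  norm_map' h := by simp

/-- The embedding `Γ ⊗ 𝓓 → H ⊕ (Γ ⊗ 𝓓)`. -/
noncomputable def fock (T : RowContraction ι H) :
    FockTensor ι T.defectSpace →ₗᵢ[ℂ] T.DilationSpace where
  toFun f := WithLp.toLp 2 (0, f)
  map_add' h k := by
    rw [← WithLp.toLp_add, Prod.mk_add_mk, add_zero]
  map_smul' c h := by
    rw [RingHom.id_apply, ← WithLp.toLp_smul, Prod.smul_mk, smul_zero]
  norm_map' h := by simp

theorem base_apply (T : RowContraction ι H) (h : H) : T.base h = WithLp.toLp 2 (h, 0) := rfl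

theorem fock_apply (T : RowContraction ι H) (f : FockTensor ι T.defectSpace) :
    T.fock f = WithLp.toLp 2 (0, f) := rfl

theorem base_fst_add_fock_snd (T : RowContraction ι H) (x : T.DilationSpace) :
    T.base x.fst + T.fock x.snd = x := by
  rw [base_apply, fock_apply, ← WithLp.toLp_add, Prod.mk_add_mk, add_zero, zero_add]
  rfl

theorem inner_base (T : RowContraction ι H) (h : H) (x : T.DilationSpace) :
    inner ℂ (T.base h) x = inner ℂ h x.fst := by
  rw [WithLp.prod_inner_apply]
  change inner ℂ h x.fst + inner ℂ (0 : FockTensor ι T.defectSpace) x.snd = _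
  rw [inner_zero_left, add_zero]

theorem inner_fock (T : RowContraction ι H) (f : FockTensor ι T.defectSpace)
    (x : T.DilationSpace) : inner ℂ (T.fock f) x = inner ℂ f x.snd := by
  rw [WithLp.prod_inner_apply]
  change inner ℂ (0 : H) x.fst + inner ℂ f x.snd = _
  rw [inner_zero_left, zero_add]

theorem fst_dilation (T : RowContraction ι H) (i : ι) (x : T.DilationSpace) :
    (T.dilation i x).fst = T.op i x.fst := rfl

theorem dilation_base (T : RowContraction ι H) (i : ι) (h : H) :
    T.dilation i (T.base h) =
      T.base (T.op i h) + T.fock (FockTensor.vacuum (T.defectComponent i h)) := by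
  rw [base_apply, dilation_apply, map_zero, add_zero, base_apply, fock_apply, ← WithLp.toLp_add,
    Prod.mk_add_mk, add_zero, zero_add]

theorem dilation_fock (T : RowContraction ι H) (i : ι) (f : FockTensor ι T.defectSpace) :
    T.dilation i (T.fock f) = T.fock (FockTensor.creation i f) := by
  rw [fock_apply, dilation_apply, map_zero, map_zero, map_zero, zero_add, fock_apply]

open Classical in
/-- The dilation is a row isometry. -/
theorem inner_dilation (T : RowContraction ι H) (i j : ι) (x y : T.DilationSpace) :
    inner ℂ (T.dilation i x) (T.dilation j y) = if i = j then inner ℂ x y else 0 := by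
  rw [WithLp.prod_inner_apply, WithLp.prod_inner_apply]
  change inner ℂ (T.op i x.fst) (T.op j y.fst) +
    inner ℂ (FockTensor.vacuum (T.defectComponent i x.fst) + FockTensor.creation i x.snd)
      (FockTensor.vacuum (T.defectComponent j y.fst) + FockTensor.creation j y.snd) =
      if i = j then inner ℂ x.fst y.fst + inner ℂ x.snd y.snd else 0
  have h0 : inner ℂ (FockTensor.creation i x.snd)
      (FockTensor.vacuum (T.defectComponent j y.fst)) = 0 := by
    rw [← inner_conj_symm, FockTensor.inner_vacuum_creation, map_zero]
  rw [inner_add_left, inner_add_right, inner_add_right, FockTensor.inner_vacuum_creation, h0,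
    FockTensor.inner_creation_creation, FockTensor.inner_vacuum, FockTensor.vacuum_nil,
    inner_defectComponent]
  split_ifs <;> ring

theorem adjoint_dilation_dilation_self (T : RowContraction ι H) (i : ι) (x : T.DilationSpace) :
    adjoint (T.dilation i) (T.dilation i x) = x := by
  refine ext_inner_right ℂ fun y => ?_
  rw [ContinuousLinearMap.adjoint_inner_left, inner_dilation, if_pos rfl]

theorem adjoint_dilation_dilation_of_ne (T : RowContraction ι H) {i j : ι} (hij : i ≠ j)
    (x : T.DilationSpace) : adjoint (T.dilation i) (T.dilation j x) = 0 := by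
  refine ext_inner_right ℂ fun y => ?_
  rw [ContinuousLinearMap.adjoint_inner_left, inner_dilation, if_neg hij.symm, inner_zero_left]

theorem adjoint_dilation_base (T : RowContraction ι H) (i : ι) (h : H) :
    adjoint (T.dilation i) (T.base h) = T.base (adjoint (T.op i) h) := by
  refine ext_inner_right ℂ fun y => ?_
  rw [ContinuousLinearMap.adjoint_inner_left, inner_base, inner_base, fst_dilation,
    ContinuousLinearMap.adjoint_inner_left]

/-- The dilation is minimal: `H` is cyclic for the tuple `V`. -/
theorem eq_top_of_dilation_mem (T : RowContraction ι H) (S : Submodule ℂ T.DilationSpace)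
    (hS : IsClosed (S : Set T.DilationSpace)) (hb : ∀ h, T.base h ∈ S)
    (hV : ∀ i, ∀ x ∈ S, T.dilation i x ∈ S) : S = ⊤ := by
  have hvac : S.comap (T.fock.toLinearMap ∘ₗ
      (FockTensor.vacuum : T.defectSpace →L[ℂ] FockTensor ι T.defectSpace).toLinearMap) = ⊤ := by
    refine T.eq_top_of_defectComponent_mem _ (hS.preimage (T.fock.continuous.comp
      (FockTensor.vacuum : T.defectSpace →L[ℂ] FockTensor ι T.defectSpace).continuous))
      fun i h => ?_
    have h1 := S.sub_mem (hV i _ (hb h)) (hb (T.op i h))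
    rwa [dilation_base, add_sub_cancel_left] at h1
  have hfock : S.comap T.fock.toLinearMap = ⊤ := by
    refine FockTensor.eq_top_of_creation_mem _ (hS.preimage T.fock.continuous)
      (fun d => ?_) fun i f hf => ?_
    · exact (Submodule.eq_top_iff'.1 hvac) d
    · change T.fock (FockTensor.creation i f) ∈ S
      rw [← dilation_fock]
      exact hV i _ hf
  refine Submodule.eq_top_iff'.2 fun x => ?_
  rw [← T.base_fst_add_fock_snd x]
  exact S.add_mem (hb _) ((Submodule.eq_top_iff'.1 hfock) x.snd)

/-- Operators that intertwine the dilation with a tuple `R` are determined by their restrictions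
to `H`. -/
theorem eq_of_intertwine (T : RowContraction ι H) {E : Type*} [NormedAddCommGroup E]
    [InnerProductSpace ℂ E] (R : ι → E →L[ℂ] E) (J J' : T.DilationSpace →L[ℂ] E)
    (hJ : ∀ i x, J (T.dilation i x) = R i (J x)) (hJ' : ∀ i x, J' (T.dilation i x) = R i (J' x))
    (hb : ∀ h, J (T.base h) = J' (T.base h)) (x : T.DilationSpace) : J x = J' x := by
  have h := T.eq_top_of_dilation_mem (LinearMap.eqLocus J.toLinearMap J'.toLinearMap)
    (isClosed_eq J.continuous J'.continuous) hb fun i x (hx : J x = J' x) => by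
      change J (T.dilation i x) = J' (T.dilation i x)
      rw [hJ, hJ', hx]
  exact (Submodule.eq_top_iff'.1 h) x

/-- `T T^* = 1` for a coisometric tuple, which makes the defect operator vanish on the range
of `T^*`. -/
theorem IsCoisometric.defectOp_column {T : RowContraction ι H} (hT : T.IsCoisometric) (h : H) :
    T.row (T.column h) = h ∧ T.defectOp (T.column h) = 0 := by
  classical
  have h1 : T.row (T.column h) = h := by
    have h2 := (lp.hasSum_single (E := fun _ : ι => H) (p := 2) (by simp) (T.column h)).mapL T.row
    simp only [row_single, column_apply] at h2
    exact h2.unique (hT h)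
  refine ⟨h1, ?_⟩
  have h3 := T.inner_defectOp (T.column h) (T.column h)
  have h4 : inner ℂ (T.column h) (T.column h) = inner ℂ (T.row (T.column h)) h := by
    rw [row, ContinuousLinearMap.adjoint_inner_left]
  rw [h4, h1, sub_self] at h3
  exact inner_self_eq_zero.1 h3

theorem IsCoisometric.hasSum_dilation {T : RowContraction ι H} (hT : T.IsCoisometric) (h : H) :
    HasSum (fun i => T.dilation i (T.base (adjoint (T.op i) h))) (T.base h) := by
  classical
  have h1 := (hT h).mapL T.base.toContinuousLinearMap
  have h2 := (lp.hasSum_single (E := fun _ : ι => H) (p := 2) (by simp) (T.column h)).mapL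
    (T.fock.toContinuousLinearMap ∘L FockTensor.vacuum ∘L
      (T.defectOp.codRestrict T.defectSpace
        (fun _ => Submodule.le_topologicalClosure _ (LinearMap.mem_range_self _ _))))
  have h3 := h1.add h2
  have h4 : (T.defectOp.codRestrict T.defectSpace (fun _ => Submodule.le_topologicalClosure _
      (LinearMap.mem_range_self _ _))) (T.column h) = 0 := Subtype.ext (hT.defectOp_column h).2
  simp only [ContinuousLinearMap.comp_apply, h4, map_zero, add_zero] at h3
  refine h3.congr_fun fun i => ?_
  exact T.dilation_base i _

end DilationBasics

end RowContraction

namespace RowContraction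

section Lifting

variable {ι : Type w} {H : Type u} [NormedAddCommGroup H] [InnerProductSpace ℂ H] [CompleteSpace H]
  {K : Type v} [NormedAddCommGroup K] [InnerProductSpace ℂ K] [CompleteSpace K]

/-! ### Lifting isometries to the dilation spaces -/

/-- The vector `V_α h` for a word `α` and `h ∈ H`. -/
noncomputable def wordVector (T : RowContraction ι H) (h : H) : List ι → T.DilationSpace
  | [] => T.base h
  | i :: α => T.dilation i (T.wordVector h α)

theorem span_wordVector (T : RowContraction ι H) :
    (Submodule.span ℂ (Set.range fun p : H × List ι => T.wordVector p.1 p.2)).topologicalClosure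
      = ⊤ := by
  set S := Submodule.span ℂ (Set.range fun p : H × List ι => T.wordVector p.1 p.2)
  refine T.eq_top_of_dilation_mem _ S.isClosed_topologicalClosure
    (fun h => S.le_topologicalClosure (Submodule.subset_span ⟨(h, []), rfl⟩)) fun i x hx => ?_
  have h1 : S ≤ S.comap (T.dilation i).toLinearMap := by
    refine Submodule.span_le.2 ?_
    rintro _ ⟨⟨h, α⟩, rfl⟩
    exact Submodule.subset_span ⟨(h, i :: α), rfl⟩
  exact map_mem_closure (T.dilation i).continuous hx fun y hy => h1 hy

theorem inner_wordVector {A : RowContraction ι H} {B : RowContraction ι K} (j : H →ₗᵢ[ℂ] K)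
    (hj : ∀ i h, j (adjoint (A.op i) h) = adjoint (B.op i) (j h)) (h k : H) (α β : List ι) :
    inner ℂ (A.wordVector h α) (A.wordVector k β) =
      inner ℂ (B.wordVector (j h) α) (B.wordVector (j k) β) := by
  have hnil : ∀ (h k : H) (β : List ι), inner ℂ (A.wordVector h []) (A.wordVector k β) =
      inner ℂ (B.wordVector (j h) []) (B.wordVector (j k) β) := by
    intro h k β
    induction β generalizing h with
    | nil =>
      simp only [wordVector, LinearIsometry.inner_map_map]
    | cons i β ih =>
      have h1 := ih (adjoint (A.op i) h)
      rw [hj] at h1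
      simpa only [wordVector, ← ContinuousLinearMap.adjoint_inner_left,
        adjoint_dilation_base] using h1
  induction α generalizing β with
  | nil => exact hnil h k β
  | cons i α ih =>
    cases β with
    | nil => rw [← inner_conj_symm, hnil, inner_conj_symm]
    | cons l β =>
      classical
      simp only [wordVector, inner_dilation]
      rw [ih]

/-- An isometry `j : H → K` with `j A_i^* = B_i^* j` extends to an isometry between the dilation
spaces that intertwines the dilations. -/
theorem exists_lift {A : RowContraction ι H} {B : RowContraction ι K} (j : H →ₗᵢ[ℂ] K)
    (hj : ∀ i h, j (adjoint (A.op i) h) = adjoint (B.op i) (j h)) :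
    ∃ J : A.DilationSpace →ₗᵢ[ℂ] B.DilationSpace,
      (∀ i x, J (A.dilation i x) = B.dilation i (J x)) ∧ ∀ h, J (A.base h) = B.base (j h) := by
  obtain ⟨J, hJ⟩ := exists_linearIsometry_of_inner_eq
    (fun p : H × List ι => A.wordVector p.1 p.2) (fun p => B.wordVector (j p.1) p.2)
    (fun p q => inner_wordVector j hj p.1 q.1 p.2 q.2) A.span_wordVector
  refine ⟨J, fun i x => ?_, fun h => hJ (h, [])⟩
  have h1 : (J.toContinuousLinearMap ∘L A.dilation i) = B.dilation i ∘L J.toContinuousLinearMap := by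
    refine ContinuousLinearMap.ext_on
      (Submodule.dense_iff_topologicalClosure_eq_top.2 A.span_wordVector) ?_
    rintro _ ⟨⟨h, α⟩, rfl⟩
    exact (hJ (h, i :: α)).trans (congrArg (B.dilation i) (hJ (h, α)).symm)
  exact DFunLike.congr_fun h1 x

/-- The lift of an isometry also intertwines the adjoints of the dilations. -/
theorem lift_adjoint {A : RowContraction ι H} {B : RowContraction ι K} {j : H →ₗᵢ[ℂ] K}
    (hj : ∀ i h, j (adjoint (A.op i) h) = adjoint (B.op i) (j h))
    {J : A.DilationSpace →ₗᵢ[ℂ] B.DilationSpace}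
    (hJ : ∀ i x, J (A.dilation i x) = B.dilation i (J x)) (hJb : ∀ h, J (A.base h) = B.base (j h))
    (i : ι) (x : A.DilationSpace) :
    J (adjoint (A.dilation i) x) = adjoint (B.dilation i) (J x) := by
  have h := A.eq_top_of_dilation_mem (LinearMap.eqLocus
    (J.toContinuousLinearMap ∘L adjoint (A.dilation i)).toLinearMap
    (adjoint (B.dilation i) ∘L J.toContinuousLinearMap).toLinearMap)
    (isClosed_eq (ContinuousLinearMap.continuous _) (ContinuousLinearMap.continuous _))
    (fun h => ?_) fun l x _ => ?_
  · exact (Submodule.eq_top_iff'.1 h) x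
  · change J (adjoint (A.dilation i) (A.base h)) = adjoint (B.dilation i) (J (A.base h))
    rw [adjoint_dilation_base, hJb, hJb, adjoint_dilation_base, hj]
  · change J (adjoint (A.dilation i) (A.dilation l x)) =
      adjoint (B.dilation i) (J (A.dilation l x))
    rw [hJ]
    by_cases hil : i = l
    · subst hil
      rw [adjoint_dilation_dilation_self, adjoint_dilation_dilation_self]
    · rw [adjoint_dilation_dilation_of_ne _ hil, adjoint_dilation_dilation_of_ne _ hil, map_zero]

/-! ### Ergodicity and the range of the lift -/

/-- The compression to `H` of an operator commuting with the dilation of an ergodic coisometric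
tuple is a fixed point of `x ↦ ∑ T_i x T_i^*`, hence a scalar. -/
theorem IsErgodic.exists_compression_eq {T : RowContraction ι H} (hT : T.IsErgodic)
    (hTc : T.IsCoisometric) (R : T.DilationSpace →L[ℂ] T.DilationSpace)
    (hR : ∀ i x, R (T.dilation i x) = T.dilation i (R x)) :
    ∃ c : ℂ, ∀ h, (R (T.base h)).fst = c • h := by
  obtain ⟨c, hc⟩ := hT (WithLp.fstL 2 ℂ H (FockTensor ι T.defectSpace) ∘L R ∘L
    T.base.toContinuousLinearMap) fun h => by
      have h1 := (hTc.hasSum_dilation h).mapL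
        (WithLp.fstL 2 ℂ H (FockTensor ι T.defectSpace) ∘L R)
      refine h1.congr_fun fun i => ?_
      change T.op i (R (T.base (adjoint (T.op i) h))).fst = (R (T.dilation i _)).fst
      rw [hR, fst_dilation]
  exact ⟨c, fun h => DFunLike.congr_fun hc h⟩

theorem eq_base_of_norm_le (T : RowContraction ι H) {z : T.DilationSpace} {h : H}
    (hz : z.fst = h) (hle : ‖z‖ ≤ ‖h‖) : z = T.base h := by
  have h1 := WithLp.prod_norm_sq_eq_of_L2 z
  rw [hz] at h1
  have h2 : ‖z.snd‖ ^ 2 ≤ 0 := by nlinarith [norm_nonneg z, norm_nonneg h]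
  have hsnd : z.snd = 0 :=
    norm_eq_zero.1 (pow_eq_zero_iff two_ne_zero |>.1 (le_antisymm h2 (sq_nonneg _)))
  rw [← T.base_fst_add_fock_snd z, hz, hsnd, map_zero, add_zero]

/-- If `T` is ergodic and coisometric, then an isometry from another dilation space that
intertwines the dilations and their adjoints is onto as soon as its range contains a nonzero
vector of `H`. -/
theorem IsErgodic.surjective_of_intertwine {B : RowContraction ι K} {T : RowContraction ι H}
    (hT : T.IsErgodic) (hTc : T.IsCoisometric)
    (J : B.DilationSpace →ₗᵢ[ℂ] T.DilationSpace)
    (hJ : ∀ i x, J (B.dilation i x) = T.dilation i (J x))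
    (hJ' : ∀ i x, J (adjoint (B.dilation i) x) = adjoint (T.dilation i) (J x))
    {Ω : H} (hΩ : Ω ≠ 0) {y : B.DilationSpace} (hy : J y = T.base Ω) :
    Function.Surjective J := by
  set Jc := J.toContinuousLinearMap
  have hJadj : ∀ i x, adjoint Jc (T.dilation i x) = B.dilation i (adjoint Jc x) := by
    intro i x
    refine ext_inner_right ℂ fun z => ?_
    rw [ContinuousLinearMap.adjoint_inner_left, ← ContinuousLinearMap.adjoint_inner_right,
      ← ContinuousLinearMap.adjoint_inner_right (B.dilation i),
      ContinuousLinearMap.adjoint_inner_left]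
    exact congrArg _ (hJ' i z).symm
  have hJJ : ∀ x, adjoint Jc (J x) = x := by
    intro x
    refine ext_inner_right ℂ fun z => ?_
    rw [ContinuousLinearMap.adjoint_inner_left]
    exact J.inner_map_map x z
  -- The projection onto the range of `J` commutes with the dilation, so it compresses to a scalar.
  obtain ⟨c, hc⟩ := hT.exists_compression_eq hTc (Jc ∘L adjoint Jc) fun i x => by
    change J (adjoint Jc (T.dilation i x)) = T.dilation i (J (adjoint Jc x))
    rw [hJadj, hJ]
  have hc1 : c = 1 := by
    have h1 := hc Ω
    change (J (adjoint Jc (T.base Ω))).fst = c • Ω at h1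
    rw [← hy, hJJ, hy] at h1
    change Ω = c • Ω at h1
    have h2 : (c - 1) • Ω = 0 := by rw [sub_smul, one_smul, ← h1, sub_self]
    exact sub_eq_zero.1 ((smul_eq_zero.1 h2).resolve_right hΩ)
  have hbase : ∀ h, T.base h ∈ LinearMap.range J.toLinearMap := by
    intro h
    refine ⟨adjoint Jc (T.base h), ?_⟩
    refine T.eq_base_of_norm_le ?_ ?_
    · have h1 : (J (adjoint Jc (T.base h))).fst = c • h := hc h
      rwa [hc1, one_smul] at h1
    · exact (J.norm_map _).trans_le
        ((norm_adjoint_linearIsometry_apply_le J (T.base h)).trans_eq (T.base.norm_map h))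
  have htop := T.eq_top_of_dilation_mem (LinearMap.range J.toLinearMap)
    (by
      have h1 := J.isometry.isClosedEmbedding.isClosed_range
      exact h1) hbase (by
      rintro i _ ⟨x, rfl⟩
      exact ⟨B.dilation i x, hJ i x⟩)
  exact LinearMap.range_eq_top.1 htop

end Lifting

section Eigenvector

variable {ι : Type w} {H : Type u} [NormedAddCommGroup H] [InnerProductSpace ℂ H] [CompleteSpace H]

/-! ### Common eigenvectors of the adjoints -/

theorem adjoint_scalar (ω : ι → ℂ) (hω : HasSum (fun i => ‖ω i‖ ^ 2) 1) (i : ι) (z : ℂ) :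
    adjoint ((scalar ω hω).op i) z = (starRingEnd ℂ) (ω i) * z := by
  refine ext_inner_right ℂ fun y => ?_
  rw [ContinuousLinearMap.adjoint_inner_left]
  change inner ℂ z (ω i • y) = _
  simp only [smul_eq_mul, RCLike.inner_apply, map_mul, Complex.conj_conj]
  ring

/-- A common eigenvector `Ω` gives an isometry of the dilation space of `ω` onto that of `T`
which maps `1` to `Ω`. -/
theorem HasAdjointEigenvector.exists_equiv {T : RowContraction ι H} (hTc : T.IsCoisometric)
    (hT : T.IsErgodic) {Ω : H} {ω : ι → ℂ} (hω : HasSum (fun i => ‖ω i‖ ^ 2) 1)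
    (hΩ : ‖Ω‖ = 1) (hTΩ : T.HasAdjointEigenvector Ω ω) :
    ∃ J : (scalar ω hω).DilationSpace ≃ₗᵢ[ℂ] T.DilationSpace,
      (∀ i x, J ((scalar ω hω).dilation i x) = T.dilation i (J x)) ∧
        ∀ z, J ((scalar ω hω).base z) = T.base (z • Ω) := by
  have hj : ∀ i z, LinearIsometry.toSpanSingleton ℂ H hΩ (adjoint ((scalar ω hω).op i) z) =
      adjoint (T.op i) (LinearIsometry.toSpanSingleton ℂ H hΩ z) := by
    intro i z
    rw [adjoint_scalar]
    simp only [LinearIsometry.toSpanSingleton_apply, map_smul, hTΩ i, smul_smul, mul_comm]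
  obtain ⟨J, hJ, hJb⟩ := exists_lift (A := scalar ω hω) (B := T)
    (LinearIsometry.toSpanSingleton ℂ H hΩ) hj
  have hΩ0 : Ω ≠ 0 := fun h => by simp [h] at hΩ
  have hs := hT.surjective_of_intertwine hTc J hJ (lift_adjoint hj hJ hJb) hΩ0
    (y := (scalar ω hω).base 1) (by rw [hJb]; simp)
  exact ⟨LinearIsometryEquiv.ofSurjective J hs, hJ, hJb⟩

/-- The vectors `V_α Ω` are total, so a common eigenvector orthogonal to `Ω` vanishes. -/
theorem HasAdjointEigenvector.eq_zero_of_inner_eq_zero {T : RowContraction ι H}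
    (hTc : T.IsCoisometric) (hT : T.IsErgodic) {Ω Φ : H} {ω ω' : ι → ℂ}
    (hω : HasSum (fun i => ‖ω i‖ ^ 2) 1) (hΩ : ‖Ω‖ = 1) (hTΩ : T.HasAdjointEigenvector Ω ω)
    (hTΦ : T.HasAdjointEigenvector Φ ω') (hΦ : inner ℂ Φ Ω = 0) : Φ = 0 := by
  obtain ⟨J, hJ, hJb⟩ := hTΩ.exists_equiv hTc hT hω hΩ
  set L : (scalar ω hω).DilationSpace →L[ℂ] ℂ :=
    innerSL ℂ (T.base Φ) ∘L J.toLinearIsometry.toContinuousLinearMap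
  have hL : ∀ y, L y = inner ℂ (T.base Φ) (J y) := fun y => rfl
  have htop := (scalar ω hω).eq_top_of_dilation_mem (LinearMap.ker L.toLinearMap)
    L.isClosed_ker (fun z => by
      change L _ = 0
      rw [hL, hJb, LinearIsometry.inner_map_map, inner_smul_right, hΦ, mul_zero])
    (fun i y (hy : L y = 0) => by
      change L _ = 0
      rw [hL, hJ, ← ContinuousLinearMap.adjoint_inner_left, adjoint_dilation_base, hTΦ i,
        map_smul, inner_smul_left, ← hL, hy, mul_zero])
  have h1 : L (J.symm (T.base Φ)) = 0 := (Submodule.eq_top_iff'.1 htop) _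
  rw [hL, J.apply_symm_apply, LinearIsometry.inner_map_map] at h1
  exact inner_self_eq_zero.1 h1

/-- A common unit eigenvector of the adjoints of an ergodic coisometric tuple is unique up to a
phase, with unique eigenvalues. -/
theorem HasAdjointEigenvector.unique {T : RowContraction ι H}
    (hTc : T.IsCoisometric) (hT : T.IsErgodic) {Ω Ψ : H} {ω ω' : ι → ℂ}
    (hω : HasSum (fun i => ‖ω i‖ ^ 2) 1) (hω' : HasSum (fun i => ‖ω' i‖ ^ 2) 1)
    (hΩ : ‖Ω‖ = 1) (hΨ : ‖Ψ‖ = 1) (hTΩ : T.HasAdjointEigenvector Ω ω)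
    (hTΨ : T.HasAdjointEigenvector Ψ ω') :
    ω' = ω ∧ ∃ c : ℂ, ‖c‖ = 1 ∧ Ψ = c • Ω := by
  have hne : inner ℂ Ψ Ω ≠ 0 := fun h => by
    have := hTΩ.eq_zero_of_inner_eq_zero hTc hT hω hΩ hTΨ h
    simp [this] at hΨ
  -- Coisometry gives `⟪Ψ, Ω⟫ = ∑ ⟪T_i^* Ψ, T_i^* Ω⟫ = (∑ ω'_i \bar ω_i) ⟪Ψ, Ω⟫`.
  have hsum : HasSum (fun i => ω' i * (starRingEnd ℂ) (ω i)) 1 := by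
    have h1 := (hTc Ω).mapL (innerSL ℂ Ψ)
    have h2 : ∀ i, innerSL ℂ Ψ (T.op i (adjoint (T.op i) Ω)) =
        ω' i * (starRingEnd ℂ) (ω i) * inner ℂ Ψ Ω := by
      intro i
      rw [innerSL_apply_apply, ← ContinuousLinearMap.adjoint_inner_left, hTΩ i, hTΨ i,
        inner_smul_left, inner_smul_right, Complex.conj_conj, mul_assoc]
    simp only [h2] at h1
    have h3 := h1.mul_right (inner ℂ Ψ Ω)⁻¹
    simpa [mul_assoc, hne] using h3
  have heq : ω' = ω := by
    have h1 := (Complex.hasSum_re hsum)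
    have h2 := (hω.add hω').sub (h1.mul_left 2)
    have h3 : ∀ i, ‖ω i‖ ^ 2 + ‖ω' i‖ ^ 2 - 2 * (ω' i * (starRingEnd ℂ) (ω i)).re =
        ‖ω' i - ω i‖ ^ 2 := by
      intro i
      simp only [← Complex.normSq_eq_norm_sq, Complex.normSq_sub]
      ring
    simp only [h3] at h2
    norm_num at h2
    have h4 := (hasSum_zero_iff_of_nonneg fun i => sq_nonneg ‖ω' i - ω i‖).1 h2
    funext i
    have h5 := congrFun h4 i
    simpa [sub_eq_zero] using h5
  subst heq
  refine ⟨rfl, inner ℂ Ω Ψ, ?_⟩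
  have hΦ : Ψ - (inner ℂ Ω Ψ : ℂ) • Ω = 0 := by
    refine hTΩ.eq_zero_of_inner_eq_zero hTc hT hω hΩ (ω' := ω') (fun i => ?_) ?_
    · rw [map_sub, map_smul, hTΩ i, hTΨ i, smul_sub, smul_comm]
    · rw [inner_sub_left, inner_smul_left, inner_self_eq_norm_sq_to_K, hΩ, inner_conj_symm]
      simp
  have hΨc : Ψ = (inner ℂ Ω Ψ : ℂ) • Ω := sub_eq_zero.1 hΦ
  refine ⟨?_, hΨc⟩
  have h1 := congrArg norm hΨc
  rw [norm_smul, hΩ, hΨ, mul_one] at h1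
  exact h1.symm

end Eigenvector

end RowContraction

namespace RowContraction

section CharacteristicFunction

variable {ι : Type w} {H : Type u} [NormedAddCommGroup H] [InnerProductSpace ℂ H] [CompleteSpace H]
  {K : Type v} [NormedAddCommGroup K] [InnerProductSpace ℂ K] [CompleteSpace K]

/-! ### The extended characteristic function -/

theorem IsIntertwiner.symm_dilation {A : RowContraction ι H} {Ω : H} {ω : ι → ℂ}
    {hω : HasSum (fun i => ‖ω i‖ ^ 2) 1}
    {W : A.DilationSpace ≃ₗᵢ[ℂ] (scalar ω hω).DilationSpace} (hW : IsIntertwiner A Ω ω hω W)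
    (i : ι) (x : (scalar ω hω).DilationSpace) :
    W.symm ((scalar ω hω).dilation i x) = A.dilation i (W.symm x) := by
  rw [W.symm_apply_eq, hW.1, W.apply_symm_apply]

theorem IsIntertwiner.symm_base {A : RowContraction ι H} {Ω : H} {ω : ι → ℂ}
    {hω : HasSum (fun i => ‖ω i‖ ^ 2) 1}
    {W : A.DilationSpace ≃ₗᵢ[ℂ] (scalar ω hω).DilationSpace} (hW : IsIntertwiner A Ω ω hω W)
    (z : ℂ) : W.symm ((scalar ω hω).base z) = A.base (z • Ω) := by
  rw [W.symm_apply_eq, map_smul, map_smul, base_apply A, hW.2, ← base_apply, ← map_smul,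
    smul_eq_mul, mul_one]

theorem IsIntertwiner.unique {A : RowContraction ι H} {Ω : H} {ω : ι → ℂ}
    {hω : HasSum (fun i => ‖ω i‖ ^ 2) 1}
    {W W' : A.DilationSpace ≃ₗᵢ[ℂ] (scalar ω hω).DilationSpace} (hW : IsIntertwiner A Ω ω hω W)
    (hW' : IsIntertwiner A Ω ω hω W') : W' = W := by
  have h : ∀ y, W'.symm y = W.symm y := fun y =>
    (scalar ω hω).eq_of_intertwine A.dilation
      W'.symm.toLinearIsometry.toContinuousLinearMap
      W.symm.toLinearIsometry.toContinuousLinearMap hW'.symm_dilation hW.symm_dilation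
      (fun z => (hW'.symm_base z).trans (hW.symm_base z).symm) y
  ext1 x
  exact (W'.symm_apply_eq.1 ((h (W x)).trans (W.symm_apply_apply x))).symm

theorem IsIntertwiner.apply_fock {A : RowContraction ι H} {Ω : H} {ω : ι → ℂ}
    {hω : HasSum (fun i => ‖ω i‖ ^ 2) 1}
    {W : A.DilationSpace ≃ₗᵢ[ℂ] (scalar ω hω).DilationSpace} (hW : IsIntertwiner A Ω ω hω W)
    (f : FockTensor ι A.defectSpace) :
    W (A.fock f) = (scalar ω hω).fock (A.extCharOp Ω ω hω f) := by
  have hex : ∃ W, IsIntertwiner A Ω ω hω W := ⟨W, hW⟩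
  have h1 : A.extCharOp Ω ω hω f = (W (A.fock f)).snd := by
    rw [extCharOp, dif_pos hex, ← hW.unique hex.choose_spec]
    rfl
  -- `W` maps `Γ ⊗ 𝓓_A`, which is orthogonal to `Ω`, to the orthogonal complement of `1 ∈ ℂ`.
  have h2 : (W (A.fock f)).fst = 0 := by
    have h3 : inner ℂ (1 : ℂ) (W (A.fock f)).fst = 0 := by
      rw [← inner_base, base_apply, ← hW.2, LinearIsometryEquiv.inner_map_map, ← base_apply,
        inner_base]
      exact inner_zero_right _
    simpa using h3
  rw [h1, ← (scalar ω hω).base_fst_add_fock_snd (W (A.fock f)), h2, map_zero, zero_add]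
  rfl

theorem HasAdjointEigenvector.hasExtChar {A : RowContraction ι H} (hAc : A.IsCoisometric)
    (hA : A.IsErgodic) {Ω : H} {ω : ι → ℂ} (hω : HasSum (fun i => ‖ω i‖ ^ 2) 1)
    (hΩ : ‖Ω‖ = 1) (hAΩ : A.HasAdjointEigenvector Ω ω) : A.HasExtChar Ω ω hω := by
  obtain ⟨J, hJ, hJb⟩ := hAΩ.exists_equiv hAc hA hω hΩ
  have hW : IsIntertwiner A Ω ω hω J.symm := by
    refine ⟨fun i x => ?_, ?_⟩
    · rw [J.symm_apply_eq, hJ, J.apply_symm_apply]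
    · rw [J.symm_apply_eq, ← base_apply, ← base_apply, hJb, one_smul]
  refine ⟨⟨J.symm, hW, fun W' hW' => hW.unique hW', hW.apply_fock⟩, fun f => ?_, fun i f => ?_⟩
  · rw [← (scalar ω hω).fock.norm_map, ← hW.apply_fock, J.symm.norm_map, A.fock.norm_map]
  · refine (scalar ω hω).fock.injective ?_
    rw [← hW.apply_fock, ← dilation_fock, hW.1, hW.apply_fock, dilation_fock]

/-! ### Equivalence of extended characteristic functions -/

/-- An intertwiner of the dilations which maps `e_0 ⊗ 𝓓_A` into `Γ ⊗ 𝓓_B` maps `Γ ⊗ 𝓓_A` into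
`Γ ⊗ 𝓓_B`. -/
theorem fst_map_fock_eq_zero {A : RowContraction ι H} {B : RowContraction ι K}
    (R : A.DilationSpace →L[ℂ] B.DilationSpace)
    (hR : ∀ i x, R (A.dilation i x) = B.dilation i (R x))
    (hRv : ∀ d, (R (A.fock (FockTensor.vacuum d))).fst = 0) (f : FockTensor ι A.defectSpace) :
    (R (A.fock f)).fst = 0 := by
  set L := WithLp.fstL 2 ℂ K (FockTensor ι B.defectSpace) ∘L R ∘L A.fock.toContinuousLinearMap
  have h := FockTensor.eq_top_of_creation_mem (LinearMap.ker L.toLinearMap) L.isClosed_ker hRv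
    fun i f (hf : (R (A.fock f)).fst = 0) => by
      change (R (A.fock (FockTensor.creation i f))).fst = 0
      rw [← dilation_fock, hR, fst_dilation, hf, map_zero]
  exact (Submodule.eq_top_iff'.1 h) f

/-- An intertwiner that maps `Γ ⊗ 𝓓_A` onto `Γ ⊗ 𝓓_B` maps the orthogonal complements `H_A` and
`H_B` onto each other. -/
theorem eq_base_of_fst_symm_fock_eq_zero {A : RowContraction ι H} {B : RowContraction ι K}
    (R : A.DilationSpace ≃ₗᵢ[ℂ] B.DilationSpace) (hR : ∀ f, (R.symm (B.fock f)).fst = 0) (h : H) :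
    R (A.base h) = B.base (R (A.base h)).fst := by
  have hsnd : (R (A.base h)).snd = 0 := by
    refine ext_inner_left ℂ fun g => ?_
    rw [← inner_fock, inner_zero_right, ← R.symm.inner_map_map, R.symm_apply_apply,
      ← inner_conj_symm, inner_base, hR, inner_zero_right, map_zero]
  conv_lhs => rw [← B.base_fst_add_fock_snd (R (A.base h)), hsnd, map_zero, add_zero]

/-- A unitary intertwiner of the dilations that respects the subspaces `e_0 ⊗ 𝓓` restricts to a
unitary equivalence of the tuples. -/
theorem unitarilyEquivalent_of_intertwine {A : RowContraction ι H} {B : RowContraction ι K}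
    (R : A.DilationSpace ≃ₗᵢ[ℂ] B.DilationSpace)
    (hR : ∀ i x, R (A.dilation i x) = B.dilation i (R x))
    (hv : ∀ d, (R (A.fock (FockTensor.vacuum d))).fst = 0)
    (hv' : ∀ d, (R.symm (B.fock (FockTensor.vacuum d))).fst = 0) : A.UnitarilyEquivalent B := by
  have hR' : ∀ i y, R.symm (B.dilation i y) = A.dilation i (R.symm y) := fun i y => by
    rw [R.symm_apply_eq, hR, R.apply_symm_apply]
  have h1 := eq_base_of_fst_symm_fock_eq_zero R
    (fst_map_fock_eq_zero R.symm.toLinearIsometry.toContinuousLinearMap hR' hv')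
  have h2 := eq_base_of_fst_symm_fock_eq_zero R.symm
    (fst_map_fock_eq_zero R.toLinearIsometry.toContinuousLinearMap hR hv)
  refine ⟨{ toFun := fun h => (R (A.base h)).fst
            map_add' := fun h k => by rw [map_add, map_add]; rfl
            map_smul' := fun c h => by rw [map_smul, map_smul]; rfl
            invFun := fun k => (R.symm (B.base k)).fst
            left_inv := fun h => by beta_reduce; rw [← h1, R.symm_apply_apply]; rfl
            right_inv := fun k => by beta_reduce; rw [← h2, R.apply_symm_apply]; rfl
            norm_map' := fun h => ?_ }, fun i h => ?_⟩
  · change ‖(R (A.base h)).fst‖ = ‖h‖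
    rw [← B.base.norm_map, ← h1, R.norm_map, A.base.norm_map]
  · change (R (A.base (A.op i h))).fst = B.op i (R (A.base h)).fst
    rw [← fst_dilation, ← hR, dilation_base, map_add]
    change _ = (R (A.base (A.op i h))).fst +
      (R (A.fock (FockTensor.vacuum (A.defectComponent i h)))).fst
    rw [hv, add_zero]

theorem map_adjoint_of_intertwine {A : RowContraction ι H} {B : RowContraction ι K}
    (U : H ≃ₗᵢ[ℂ] K) (hU : ∀ i h, U (A.op i h) = B.op i (U h)) (i : ι) (h : H) :
    U (adjoint (A.op i) h) = adjoint (B.op i) (U h) := by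
  refine ext_inner_right ℂ fun k => ?_
  rw [ContinuousLinearMap.adjoint_inner_left]
  obtain ⟨k, rfl⟩ := U.surjective k
  rw [← hU, U.inner_map_map, U.inner_map_map, ContinuousLinearMap.adjoint_inner_left]

/-- If a unitary `U` with `U Ω_A = Ω_B` intertwines `A` and `B`, then the unitary `W_B^* W_A` is
the lift of `U`, and maps `e_0 ⊗ 𝓓_A` into `e_0 ⊗ 𝓓_B`. -/
theorem exists_symm_apply_vacuum {A : RowContraction ι H} {B : RowContraction ι K}
    {ΩA : H} {ΩB : K} {ω : ι → ℂ} {hω : HasSum (fun i => ‖ω i‖ ^ 2) 1}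
    {WA : A.DilationSpace ≃ₗᵢ[ℂ] (scalar ω hω).DilationSpace}
    (hWA : IsIntertwiner A ΩA ω hω WA)
    {WB : B.DilationSpace ≃ₗᵢ[ℂ] (scalar ω hω).DilationSpace}
    (hWB : IsIntertwiner B ΩB ω hω WB)
    (U : H ≃ₗᵢ[ℂ] K) (hU : ∀ i h, U (A.op i h) = B.op i (U h)) (hUΩ : U ΩA = ΩB)
    (d : A.defectSpace) :
    ∃ d' : B.defectSpace,
      WB.symm (WA (A.fock (FockTensor.vacuum d))) = B.fock (FockTensor.vacuum d') := by
  obtain ⟨J, hJ, hJb⟩ := exists_lift (A := A) (B := B) U.toLinearIsometry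
    (map_adjoint_of_intertwine U hU)
  have hJW : ∀ x, WB.symm (WA x) = J x := by
    intro x
    have h1 := (scalar ω hω).eq_of_intertwine B.dilation
      WB.symm.toLinearIsometry.toContinuousLinearMap
      (J.toContinuousLinearMap ∘L WA.symm.toLinearIsometry.toContinuousLinearMap)
      hWB.symm_dilation (fun i y => ?_) (fun z => ?_) (WA x)
    · refine h1.trans ?_
      change J (WA.symm (WA x)) = J x
      rw [WA.symm_apply_apply]
    · change J (WA.symm _) = B.dilation i (J (WA.symm y))
      rw [hWA.symm_dilation, hJ]
    · refine (hWB.symm_base z).trans ?_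
      change _ = J (WA.symm _)
      rw [hWA.symm_base, hJb]
      change _ = B.base (U (z • ΩA))
      rw [U.map_smul, hUΩ]
  set N : A.defectSpace →L[ℂ] B.DilationSpace :=
    J.toContinuousLinearMap ∘L A.fock.toContinuousLinearMap ∘L FockTensor.vacuum
  let vB : B.defectSpace →ₗᵢ[ℂ] B.DilationSpace :=
    B.fock.comp ⟨(FockTensor.vacuum : B.defectSpace →L[ℂ] _).toLinearMap, FockTensor.norm_vacuum⟩
  have hclosed : IsClosed (LinearMap.range vB.toLinearMap : Set B.DilationSpace) :=
    vB.isometry.isClosedEmbedding.isClosed_range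
  have htop := A.eq_top_of_defectComponent_mem
    ((LinearMap.range vB.toLinearMap).comap N.toLinearMap) (hclosed.preimage N.continuous)
    fun i h => by
      refine ⟨B.defectComponent i (U h), ?_⟩
      change B.fock (FockTensor.vacuum (B.defectComponent i (U h))) =
        J (A.fock (FockTensor.vacuum (A.defectComponent i h)))
      rw [← sub_eq_iff_eq_add'.2 (A.dilation_base i h),
        ← sub_eq_iff_eq_add'.2 (B.dilation_base i (U h)), map_sub, hJ, hJb, hJb]
      change _ = _ - B.base (U (A.op i h))
      rw [hU]
      rfl
  obtain ⟨d', hd'⟩ := (Submodule.eq_top_iff'.1 htop) d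
  exact ⟨d', (hJW _).trans hd'.symm⟩

theorem extCharEquivalent_iff {A : RowContraction ι H} {B : RowContraction ι K}
    {ΩA : H} {ΩB : K} {ω : ι → ℂ} (hω : HasSum (fun i => ‖ω i‖ ^ 2) 1)
    (hΩA : ‖ΩA‖ = 1) (hΩB : ‖ΩB‖ = 1)
    (hAc : A.IsCoisometric) (hA : A.IsErgodic) (hAΩ : A.HasAdjointEigenvector ΩA ω)
    (hBc : B.IsCoisometric) (hB : B.IsErgodic) (hBΩ : B.HasAdjointEigenvector ΩB ω) :
    A.ExtCharEquivalent ΩA B ΩB ω hω ↔ A.UnitarilyEquivalent B := by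
  obtain ⟨⟨WA, hWA, -, -⟩, -⟩ := hAΩ.hasExtChar hAc hA hω hΩA
  obtain ⟨⟨WB, hWB, -, -⟩, -⟩ := hBΩ.hasExtChar hBc hB hω hΩB
  have hθA : ∀ d, WA (A.fock (FockTensor.vacuum d)) =
    (scalar ω hω).fock (A.extChar ΩA ω hω d) := fun d => hWA.apply_fock _
  have hθB : ∀ d, WB (B.fock (FockTensor.vacuum d)) =
    (scalar ω hω).fock (B.extChar ΩB ω hω d) := fun d => hWB.apply_fock _
  constructor
  · rintro ⟨V, hV⟩
    have hRV : ∀ d, WB.symm (WA (A.fock (FockTensor.vacuum d))) =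
        B.fock (FockTensor.vacuum (V d)) := fun d => by
      rw [WB.symm_apply_eq, hθA, hθB, hV]
    refine unitarilyEquivalent_of_intertwine (WA.trans WB.symm) (fun i x => ?_) (fun d => ?_)
      fun d => ?_
    · change WB.symm (WA _) = B.dilation i (WB.symm (WA x))
      rw [hWA.1, hWB.symm_dilation]
    · change (WB.symm (WA _)).fst = 0
      rw [hRV]
      rfl
    · have h1 := hRV (V.symm d)
      rw [V.apply_symm_apply] at h1
      have h2 : (WA.trans WB.symm).symm (B.fock (FockTensor.vacuum d)) =
          A.fock (FockTensor.vacuum (V.symm d)) := by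
        rw [LinearIsometryEquiv.symm_apply_eq]
        exact h1.symm
      rw [h2]
      rfl
  · rintro ⟨U, hU⟩
    -- `U Ω_A` is a common eigenvector for `B`, so it is a multiple of `Ω_B`; correct the phase.
    have hUΩ : B.HasAdjointEigenvector (U ΩA) ω := fun i => by
      rw [← map_adjoint_of_intertwine U hU, hAΩ i, map_smul]
    obtain ⟨-, c, hc, hcΩ⟩ := hBΩ.unique hBc hB hω hω hΩB ((U.norm_map _).trans hΩA) hUΩ
    obtain ⟨U', hU'⟩ := exists_smul_linearIsometryEquiv U (c := c⁻¹) (by rw [norm_inv, hc, inv_one])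
    have hUop : ∀ i h, U' (A.op i h) = B.op i (U' h) := fun i h => by
      rw [hU', hU', hU, map_smul]
    have hUΩ' : U' ΩA = ΩB := by
      have hc0 : c ≠ 0 := fun h => by simp [h] at hc
      rw [hU', hcΩ, smul_smul, inv_mul_cancel₀ hc0, one_smul]
    have hAB := exists_symm_apply_vacuum hWA hWB U' hUop hUΩ'
    have hBA := exists_symm_apply_vacuum hWB hWA U'.symm
      (fun i k => by rw [U'.symm_apply_eq, hUop, U'.apply_symm_apply])
      (by rw [U'.symm_apply_eq, hUΩ'])
    choose V hV using hAB
    choose V' hV' using hBA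
    have hinjA : Function.Injective fun d : A.defectSpace => A.fock (FockTensor.vacuum d) :=
      A.fock.injective.comp FockTensor.vacuum_injective
    have hinjB : Function.Injective fun d : B.defectSpace => B.fock (FockTensor.vacuum d) :=
      B.fock.injective.comp FockTensor.vacuum_injective
    refine ⟨{ toFun := V
              map_add' := fun d e => hinjB ?_
              map_smul' := fun a d => hinjB ?_
              invFun := V'
              left_inv := fun d => hinjA ?_
              right_inv := fun d => hinjB ?_
              norm_map' := fun d => ?_ }, fun d => ?_⟩
    · simp only [map_add, ← hV]
    · simp only [map_smul, ← hV, RingHom.id_apply]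
    · simp only [← hV', ← hV, WB.apply_symm_apply, WA.symm_apply_apply]
    · simp only [← hV', ← hV, WA.apply_symm_apply, WB.symm_apply_apply]
    · change ‖V d‖ = ‖d‖
      rw [← FockTensor.norm_vacuum (ι := ι) (V d), ← B.fock.norm_map, ← hV, WB.symm.norm_map,
        WA.norm_map, A.fock.norm_map, FockTensor.norm_vacuum]
    · change _ = B.extChar ΩB ω hω (V d)
      refine (scalar ω hω).fock.injective ?_
      rw [← hθA, ← hθB, ← hV, WB.apply_symm_apply]

end CharacteristicFunction

end RowContraction

/-! ### Kraus tuples of ergodic completely positive maps -/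

namespace RowContraction

section Kraus

variable {ι : Type w} {H : Type u} [NormedAddCommGroup H] [InnerProductSpace ℂ H] [CompleteSpace H]
  {K : Type v} [NormedAddCommGroup K] [InnerProductSpace ℂ K] [CompleteSpace K]

theorem sum_comp_adjoint_le_one (T : ι → H →L[ℂ] H) (s : Finset ι)
    (hT : ∀ h, ∑ i ∈ s, ‖adjoint (T i) h‖ ^ 2 ≤ ‖h‖ ^ 2) : ∑ i ∈ s, T i ∘L adjoint (T i) ≤ 1 := by
  rw [ContinuousLinearMap.le_def, ContinuousLinearMap.isPositive_def']
  refine ⟨(IsSelfAdjoint.one _).sub ?_, fun h => ?_⟩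
  · rw [IsSelfAdjoint, star_sum]
    refine Finset.sum_congr rfl fun i _ => ?_
    rw [ContinuousLinearMap.star_eq_adjoint, ContinuousLinearMap.adjoint_comp,
      ContinuousLinearMap.adjoint_adjoint]
  · have h3 : ∀ i, RCLike.re (inner ℂ (T i (adjoint (T i) h)) h) = ‖adjoint (T i) h‖ ^ 2 := by
      intro i
      rw [← ContinuousLinearMap.adjoint_inner_right, inner_self_eq_norm_sq]
    rw [ContinuousLinearMap.reApplyInnerSelf_apply]
    simp only [sub_apply, one_apply_eq_self, inner_sub_left, sum_apply,
      ContinuousLinearMap.comp_apply, sum_inner, map_sub, map_sum, h3, inner_self_eq_norm_sq]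
    linarith [hT h]

theorem adjoint_conj_apply (T : H →L[ℂ] H) (U : H ≃ₗᵢ[ℂ] K) (k : K) :
    adjoint ((U : H →L[ℂ] K) ∘L T ∘L (U.symm : K →L[ℂ] H)) k = U (adjoint T (U.symm k)) := by
  refine ext_inner_right ℂ fun y => ?_
  rw [ContinuousLinearMap.adjoint_inner_left]
  change inner ℂ k (U (T (U.symm y))) = _
  rw [← U.symm.inner_map_map, U.symm_apply_apply, ← ContinuousLinearMap.adjoint_inner_left,
    ← U.inner_map_map, U.apply_symm_apply]

/-- The tuple `(U T_i U^*)_i` for a unitary `U`. -/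
noncomputable def conj (T : RowContraction ι H) (U : H ≃ₗᵢ[ℂ] K) : RowContraction ι K where
  op i := (U : H →L[ℂ] K) ∘L T.op i ∘L (U.symm : K →L[ℂ] H)
  sum_le_one s := sum_comp_adjoint_le_one _ s fun k => by
    simp only [adjoint_conj_apply, U.norm_map]
    simpa only [U.symm.norm_map] using T.sum_norm_sq_le s (U.symm k)

theorem conj_op_apply (T : RowContraction ι H) (U : H ≃ₗᵢ[ℂ] K) (i : ι) (k : K) :
    (T.conj U).op i k = U (T.op i (U.symm k)) := rfl

theorem adjoint_conj_op_apply (T : RowContraction ι H) (U : H ≃ₗᵢ[ℂ] K) (i : ι) (k : K) :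
    adjoint ((T.conj U).op i) k = U (adjoint (T.op i) (U.symm k)) :=
  adjoint_conj_apply (T.op i) U k

theorem unitarilyEquivalent_conj (T : RowContraction ι H) (U : H ≃ₗᵢ[ℂ] K) :
    T.UnitarilyEquivalent (T.conj U) :=
  ⟨U, fun i h => by rw [conj_op_apply, U.symm_apply_apply]⟩

variable {A : RowContraction ι H} {Z : (H →L[ℂ] H) →CP (H →L[ℂ] H)}

theorem IsMinimalKraus.isCoisometric (hA : A.IsMinimalKraus Z) (hZ : Z 1 = 1) :
    A.IsCoisometric := fun h => by
  have h1 := hA.1 1 h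
  rwa [hZ] at h1

theorem IsMinimalKraus.isErgodic (hA : A.IsMinimalKraus Z)
    (hZ : ∀ x, Z x = x → ∃ c : ℂ, x = c • (1 : H →L[ℂ] H)) : A.IsErgodic := fun x hx =>
  hZ x (ContinuousLinearMap.ext fun h => (hA.1 x h).unique (hx h))

/-- An invariant vector state is given by a common eigenvector of the adjoints of
the Kraus operators: invariance, applied to the projection `1 - p` onto `Ω^⊥`, says that
`∑ ‖(1 - p) A_i^* Ω‖² = 0`. -/
theorem IsMinimalKraus.exists_eigenvalues (hA : A.IsMinimalKraus Z) {Ω : H} (hΩ : ‖Ω‖ = 1) (hinv : ∀ x, inner ℂ Ω (Z x Ω) = inner ℂ Ω (x Ω)) :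
    ∃ ω : ι → ℂ, HasSum (fun i => ‖ω i‖ ^ 2) 1 ∧ A.HasAdjointEigenvector Ω ω := by
  have hsum : ∀ x : H →L[ℂ] H, HasSum
      (fun i => RCLike.re (inner ℂ (adjoint (A.op i) Ω) (x (adjoint (A.op i) Ω))))
      (RCLike.re (inner ℂ Ω (x Ω))) := by
    intro x
    have h1 := Complex.hasSum_re ((hA.1 x Ω).mapL (innerSL ℂ Ω))
    simp only [innerSL_apply_apply, hinv] at h1
    refine h1.congr_fun fun i => ?_
    rw [ContinuousLinearMap.adjoint_inner_left]
    rfl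
  have hone : HasSum (fun i => ‖adjoint (A.op i) Ω‖ ^ 2) 1 := by
    have h1 := hsum 1
    simpa only [one_apply_eq_self, inner_self_eq_norm_sq, hΩ, one_pow] using h1
  have hp : HasSum (fun i => ‖inner ℂ Ω (adjoint (A.op i) Ω)‖ ^ 2) 1 := by
    have h1 := hsum (InnerProductSpace.rankOne ℂ Ω Ω)
    have h2 : ∀ y : H, RCLike.re (inner ℂ y (InnerProductSpace.rankOne ℂ Ω Ω y)) =
        ‖inner ℂ Ω y‖ ^ 2 := by
      intro y
      rw [InnerProductSpace.rankOne_apply, inner_smul_right, ← inner_conj_symm y Ω,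
        RCLike.mul_conj]
      norm_cast
    simp only [h2, inner_self_eq_norm_sq_to_K, hΩ] at h1
    simpa using h1
  have hdiff : ∀ i, adjoint (A.op i) Ω = (inner ℂ Ω (adjoint (A.op i) Ω) : ℂ) • Ω := by
    have h1 : ∀ y : H, ‖y - (inner ℂ Ω y : ℂ) • Ω‖ ^ 2 = ‖y‖ ^ 2 - ‖inner ℂ Ω y‖ ^ 2 := by
      intro y
      rw [@norm_sub_sq ℂ, inner_smul_right, ← inner_conj_symm y Ω, RCLike.mul_conj, norm_smul, hΩ]
      norm_cast
      ring
    have h2 := hone.sub hp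
    simp only [← h1, sub_self] at h2
    have h3 := (hasSum_zero_iff_of_nonneg fun i => sq_nonneg _).1 h2
    intro i
    have h4 := congrFun h3 i
    simpa [sub_eq_zero] using h4
  refine ⟨fun i => (starRingEnd ℂ) (inner ℂ Ω (adjoint (A.op i) Ω)), ?_, fun i => ?_⟩
  · simpa only [RCLike.norm_conj] using hp
  · rw [Complex.conj_conj]
    exact hdiff i

theorem IsMinimalKraus.conj {Z' : (K →L[ℂ] K) →CP (K →L[ℂ] K)} (hA : A.IsMinimalKraus Z)
    (U : H ≃ₗᵢ[ℂ] K) (hU : ∀ x : H →L[ℂ] H, Z x = (U.symm : K →L[ℂ] H) ∘L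
      Z' ((U : H →L[ℂ] K) ∘L x ∘L (U.symm : K →L[ℂ] H)) ∘L (U : H →L[ℂ] K)) :
    (A.conj U).IsMinimalKraus Z' := by
  refine ⟨fun y k => ?_, fun c hc => hA.2 c fun h => ?_⟩
  · set x : H →L[ℂ] H := (U.symm : K →L[ℂ] H) ∘L y ∘L (U : H →L[ℂ] K) with hx
    have hxy : (U : H →L[ℂ] K) ∘L x ∘L (U.symm : K →L[ℂ] H) = y := by
      ext k
      change U (U.symm (y (U (U.symm k)))) = y k
      rw [U.apply_symm_apply, U.apply_symm_apply]
    have h1 := (hA.1 x (U.symm k)).mapL (U : H →L[ℂ] K)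
    have h2 : U (Z x (U.symm k)) = Z' y k := by
      rw [hU x, hxy]
      change U (U.symm (Z' y (U (U.symm k)))) = _
      rw [U.apply_symm_apply, U.apply_symm_apply]
    change HasSum _ (U (Z x (U.symm k))) at h1
    rw [h2] at h1
    refine h1.congr_fun fun i => ?_
    rw [conj_op_apply, adjoint_conj_op_apply]
    rfl
  · have h1 := (hc (U h)).mapL (U.symm : K →L[ℂ] H)
    rw [map_zero] at h1
    refine h1.congr_fun fun i => ?_
    change _ = U.symm (c i • U (A.op i (U.symm (U h))))
    rw [map_smul, U.symm_apply_apply, U.symm_apply_apply]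

theorem IsMinimalKraus.conjugate {Z' : (K →L[ℂ] K) →CP (K →L[ℂ] K)} (hA : A.IsMinimalKraus Z)
    {B : RowContraction ι K} (hB : B.IsMinimalKraus Z') (hAB : A.UnitarilyEquivalent B) :
    CPMap.Conjugate Z Z' := by
  obtain ⟨U, hU⟩ := hAB
  refine ⟨U, fun x => ContinuousLinearMap.ext fun h => ?_⟩
  have h1 := (hB.1 ((U : H →L[ℂ] K) ∘L x ∘L (U.symm : K →L[ℂ] H)) (U h)).mapL
    (U.symm : K →L[ℂ] H)
  refine (hA.1 x h).unique (h1.congr_fun fun i => ?_)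
  change _ = U.symm (B.op i (U (x (U.symm (adjoint (B.op i) (U h))))))
  rw [← map_adjoint_of_intertwine U hU, U.symm_apply_apply, ← hU, U.symm_apply_apply]

/-- The choice of the minimal Kraus decomposition of `Z₁` does not matter. -/
theorem IsMinimalKraus.exists_extCharEquivalent_iff {Z' : (K →L[ℂ] K) →CP (K →L[ℂ] K)} {ΩH : H}
    {ΩK : K} (hΩH : ‖ΩH‖ = 1) (hΩK : ‖ΩK‖ = 1) (hZ : CPMap.IsNormalUnitalErgodic Z ΩH)
    (hZ' : CPMap.IsNormalUnitalErgodic Z' ΩK) (hA : A.IsMinimalKraus Z) :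
    ∃ (ω : ι → ℂ) (hω : HasSum (fun i => ‖ω i‖ ^ 2) 1), A.HasAdjointEigenvector ΩH ω ∧
      ((∃ B : RowContraction ι K, B.IsMinimalKraus Z' ∧ B.HasAdjointEigenvector ΩK ω ∧
        A.ExtCharEquivalent ΩH B ΩK ω hω) ↔ CPMap.Conjugate Z Z') := by
  obtain ⟨ω, hω, hAω⟩ := hA.exists_eigenvalues hΩH hZ.invariant
  have hAc := hA.isCoisometric hZ.unital
  have hAe := hA.isErgodic hZ.ergodic
  refine ⟨ω, hω, hAω, ?_, ?_⟩
  · rintro ⟨B, hB, hBω, hAB⟩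
    exact hA.conjugate hB ((extCharEquivalent_iff hω hΩH hΩK hAc hAe hAω
      (hB.isCoisometric hZ'.unital) (hB.isErgodic hZ'.ergodic) hBω).1 hAB)
  · rintro ⟨U, hU⟩
    have hB := hA.conj U hU
    have hBc := hB.isCoisometric hZ'.unital
    have hBe := hB.isErgodic hZ'.ergodic
    -- The invariant vector state of `Z'` is unique, so its eigenvalue tuple is that of `U ΩH`.
    have hBU : (A.conj U).HasAdjointEigenvector (U ΩH) ω := fun i => by
      rw [adjoint_conj_op_apply, U.symm_apply_apply, hAω i, map_smul]
    obtain ⟨ω', hω', hBω'⟩ := hB.exists_eigenvalues hΩK hZ'.invariant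
    obtain ⟨hωω, -⟩ := hBω'.unique hBc hBe hω' hω hΩK ((U.norm_map _).trans hΩH) hBU
    subst hωω
    exact ⟨A.conj U, hB, hBω', (extCharEquivalent_iff hω hΩH hΩK hAc hAe hAω hBc hBe hBω').2
      (A.unitarilyEquivalent_conj U)⟩

end Kraus

end RowContraction

/-! ### Existence of minimal Kraus decompositions -/

namespace CPMap

open InnerProductSpace (rankOne)

variable {H : Type u} [NormedAddCommGroup H] [InnerProductSpace ℂ H]

theorem re_inner_le_of_le {S T : H →L[ℂ] H} (h : S ≤ T) (k : H) :
    RCLike.re (inner ℂ k (S k)) ≤ RCLike.re (inner ℂ k (T k)) := by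
  have h1 := ((ContinuousLinearMap.le_def _ _).1 h).re_inner_nonneg_right k
  rw [sub_apply, inner_sub_right, map_sub] at h1
  exact sub_nonneg.1 h1

theorem inner_rankOne_self (x k : H) :
    inner ℂ k (rankOne ℂ x x k) = ((‖inner ℂ x k‖ ^ 2 : ℝ) : ℂ) := by
  rw [InnerProductSpace.rankOne_apply, inner_smul_right, ← inner_conj_symm k x, RCLike.mul_conj]
  norm_cast

theorem re_inner_sum_rankOne {κ : Type*} (F : Finset κ) (x : κ → H) (k : H) :
    RCLike.re (inner ℂ k ((∑ j ∈ F, rankOne ℂ (x j) (x j)) k)) =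
      ∑ j ∈ F, ‖inner ℂ (x j) k‖ ^ 2 := by
  simp only [sum_apply, inner_sum, map_sum, inner_rankOne_self]
  rfl

variable [CompleteSpace H]

theorem le_of_re_inner_le {S T : H →L[ℂ] H} (hS : IsSelfAdjoint S) (hT : IsSelfAdjoint T)
    (h : ∀ k, RCLike.re (inner ℂ k (S k)) ≤ RCLike.re (inner ℂ k (T k))) : S ≤ T := by
  rw [ContinuousLinearMap.le_def, ContinuousLinearMap.isPositive_def']
  refine ⟨hT.sub hS, fun k => ?_⟩
  rw [ContinuousLinearMap.reApplyInnerSelf_apply, inner_re_symm, sub_apply, inner_sub_right,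
    map_sub]
  exact sub_nonneg.2 (h k)

theorem isSelfAdjoint_rankOne (x : H) : IsSelfAdjoint (rankOne ℂ x x) :=
  (InnerProductSpace.isPositive_rankOne_self x).isSelfAdjoint

theorem map_mono (Z : (H →L[ℂ] H) →CP (H →L[ℂ] H)) {x y : H →L[ℂ] H} (h : x ≤ y) : Z x ≤ Z y :=
  OrderHomClass.mono Z h

theorem cstarMatrix_re_inner_nonneg {n : Type*} [Fintype n] [DecidableEq n]
    {N : CStarMatrix n n (H →L[ℂ] H)} (hN : 0 ≤ N) (k : n → H) :
    0 ≤ RCLike.re (∑ a, ∑ b, inner ℂ (N b a (k a)) (k b)) := by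
  rw [StarOrderedRing.nonneg_iff] at hN
  induction hN using AddSubmonoid.closure_induction with
  | zero => simp
  | add M N _ _ hM hN =>
    have h1 : ∀ a b, inner ℂ ((M + N) b a (k a)) (k b) =
        inner ℂ (M b a (k a)) (k b) + inner ℂ (N b a (k a)) (k b) := fun a b => by
      rw [CStarMatrix.add_apply, add_apply, inner_add_left]
    simp only [h1, Finset.sum_add_distrib, map_add]
    exact add_nonneg hM hN
  | mem N hN =>
    obtain ⟨P, rfl⟩ := hN
    have h1 : ∀ a b, inner ℂ ((star P * P) b a (k a)) (k b) =
        ∑ c, inner ℂ (P c a (k a)) (P c b (k b)) := by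
      intro a b
      rw [CStarMatrix.mul_apply, sum_apply, sum_inner]
      refine Finset.sum_congr rfl fun c _ => ?_
      change inner ℂ (adjoint (P c b) (P c a (k a))) (k b) = _
      rw [ContinuousLinearMap.adjoint_inner_left]
    have h2 : ∑ a, ∑ b, inner ℂ ((star P * P) b a (k a)) (k b) =
        ∑ c, inner ℂ (∑ a, P c a (k a)) (∑ b, P c b (k b)) := by
      have h3 : ∀ c, inner ℂ (∑ a, P c a (k a)) (∑ b, P c b (k b)) =
          ∑ a, ∑ b, inner ℂ (P c a (k a)) (P c b (k b)) := fun c => by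
        rw [sum_inner]
        exact Finset.sum_congr rfl fun a _ => inner_sum _ _ _
      simp only [h1, h3]
      rw [Finset.sum_comm (s := Finset.univ (α := n)) (f := fun c a =>
        ∑ b, inner ℂ (P c a (k a)) (P c b (k b)))]
      exact Finset.sum_congr rfl fun a _ => Finset.sum_comm
    change 0 ≤ RCLike.re (∑ a, ∑ b, inner ℂ ((star P * P) b a (k a)) (k b))
    rw [h2, map_sum]
    exact Finset.sum_nonneg fun c _ => by
      rw [inner_self_eq_norm_sq]
      positivity

/-- Complete positivity, applied to the positive matrix `[|x_a⟩⟨x_b|]`. -/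
theorem re_inner_map_rankOne_nonneg (Z : (H →L[ℂ] H) →CP (H →L[ℂ] H)) {e : H} (he : ‖e‖ = 1)
    {n : Type*} [Fintype n] (x k : n → H) :
    0 ≤ RCLike.re (∑ a, ∑ b, inner ℂ (Z (rankOne ℂ (x b) (x a)) (k a)) (k b)) := by
  classical
  rcases isEmpty_or_nonempty n with hn | ⟨⟨c₀⟩⟩
  · simp
  set Q : CStarMatrix n n (H →L[ℂ] H) :=
    CStarMatrix.ofMatrix (Matrix.of fun c b => if c = c₀ then rankOne ℂ e (x b) else 0) with hQ
  have h1 : 0 ≤ star Q * Q := star_mul_self_nonneg Q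
  have h2 := cstarMatrix_re_inner_nonneg (Z.map_cstarMatrix_nonneg _ h1) k
  have h3 : ∀ a b, (star Q * Q) b a = rankOne ℂ (x b) (x a) := by
    intro a b
    rw [CStarMatrix.mul_apply]
    have h4 : ∀ c, (star Q) b c * Q c a = if c = c₀ then rankOne ℂ (x b) (x a) else 0 := by
      intro c
      change star (if c = c₀ then rankOne ℂ e (x b) else 0) *
        (if c = c₀ then rankOne ℂ e (x a) else 0) = _
      split_ifs with hc
      · change adjoint (rankOne ℂ e (x b)) ∘L rankOne ℂ e (x a) = _
        rw [InnerProductSpace.adjoint_rankOne, InnerProductSpace.rankOne_comp_rankOne,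
          inner_self_eq_norm_sq_to_K, he]
        simp
      · simp
    simp only [h4, Finset.sum_ite_eq', Finset.mem_univ, if_true]
  have h5 : ∀ a b, ((star Q * Q).map Z) b a = Z (rankOne ℂ (x b) (x a)) := fun a b => by
    rw [CStarMatrix.map_apply, h3]
  simpa only [h5] using h2

/-- The operator-valued kernel `(x, y) ↦ Z(|x⟩⟨y|)` on `H`. -/
noncomputable def choiKernel (Z : (H →L[ℂ] H) →CP (H →L[ℂ] H)) : Matrix H H (H →L[ℂ] H) :=
  Matrix.of fun x y => Z (rankOne ℂ x y)

theorem choiKernel_apply (Z : (H →L[ℂ] H) →CP (H →L[ℂ] H)) (x y : H) :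
    choiKernel Z x y = Z (rankOne ℂ x y) := rfl

theorem posSemidef_choiKernel (Z : (H →L[ℂ] H) →CP (H →L[ℂ] H)) {e : H} (he : ‖e‖ = 1) :
    (choiKernel Z).PosSemidef := by
  have hherm : (choiKernel Z).IsHermitian := by
    ext1 x y
    rw [Matrix.conjTranspose_apply, choiKernel_apply, choiKernel_apply, ← map_star,
      ContinuousLinearMap.star_eq_adjoint, InnerProductSpace.adjoint_rankOne]
  have htfae := (RKHS.posSemidef_tfae (K := choiKernel Z)).out 2 0
  refine htfae.1 ⟨hherm, fun vv => ?_⟩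
  have h1 := re_inner_map_rankOne_nonneg Z he (fun a : vv.support => (a : H))
    (fun a : vv.support => vv a)
  have h2 : vv.sum (fun x w => vv.sum fun x' w' => inner ℂ (choiKernel Z x' x w) w') =
      ∑ a : vv.support, ∑ b : vv.support,
        inner ℂ (Z (rankOne ℂ (b : H) (a : H)) (vv a)) (vv b) := by
    rw [Finsupp.sum, ← Finset.sum_coe_sort vv.support]
    refine Finset.sum_congr rfl fun a _ => ?_
    rw [Finsupp.sum, ← Finset.sum_coe_sort vv.support]
    rfl
  rw [h2]
  exact h1

/-- The elements of the reproducing kernel Hilbert space of the kernel `Z(|x⟩⟨y|)` are bounded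
operators on `H`. -/
theorem exists_clm_of_rkhs (Z : (H →L[ℂ] H) →CP (H →L[ℂ] H)) (hZ : Z 1 = 1)
    [Fact (choiKernel Z).PosSemidef] (f : RKHS.OfKernel (choiKernel Z)) :
    ∃ T : H →L[ℂ] H, ∀ x, T x = f x := by
  have hker : ∀ x y v, RKHS.kerFun (RKHS.OfKernel (choiKernel Z)) y v x = Z (rankOne ℂ x y) v := by
    intro x y v
    rw [RKHS.kerFun_apply, RKHS.OfKernel.kernel_ofKernel, choiKernel_apply]
  have hadd : ∀ x y v, RKHS.kerFun (RKHS.OfKernel (choiKernel Z)) (x + y) v =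
      RKHS.kerFun (RKHS.OfKernel (choiKernel Z)) x v +
        RKHS.kerFun (RKHS.OfKernel (choiKernel Z)) y v := by
    intro x y v
    refine RKHS.ext fun z => ?_
    rw [RKHS.coe_add, Pi.add_apply, hker, hker, hker, map_add, map_add, add_apply]
  have hsmul : ∀ (c : ℂ) x v, RKHS.kerFun (RKHS.OfKernel (choiKernel Z)) (c • x) v =
      (starRingEnd ℂ) c • RKHS.kerFun (RKHS.OfKernel (choiKernel Z)) x v := by
    intro c x v
    refine RKHS.ext fun z => ?_
    rw [RKHS.coe_smul, Pi.smul_apply, hker, hker, map_smulₛₗ, map_smul, smul_apply]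
  refine ⟨LinearMap.mkContinuous
    { toFun := f
      map_add' := fun x y => ext_inner_right ℂ fun v => ?_
      map_smul' := fun c x => ext_inner_right ℂ fun v => ?_ } ‖f‖ fun x => ?_, fun x => rfl⟩
  · rw [inner_add_left, ← RKHS.inner_kerFun, ← RKHS.inner_kerFun, ← RKHS.inner_kerFun, hadd,
      inner_add_right]
  · rw [RingHom.id_apply, inner_smul_left, ← RKHS.inner_kerFun, ← RKHS.inner_kerFun, hsmul,
      inner_smul_right]
  · refine (RKHS.norm_apply_le f x).trans ?_
    gcongr
    rw [RKHS.OfKernel.kernel_ofKernel, choiKernel_apply]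
    refine Real.sqrt_le_iff.2 ⟨norm_nonneg _, ?_⟩
    have h1 : rankOne ℂ x x ≤ ((‖x‖ ^ 2 : ℝ) : ℂ) • (1 : H →L[ℂ] H) := by
      refine le_of_re_inner_le (isSelfAdjoint_rankOne x) ?_ fun k => ?_
      · rw [IsSelfAdjoint, star_smul, star_one]
        simp
      · have h1 : ‖inner ℂ x k‖ ^ 2 ≤ ‖x‖ ^ 2 * ‖k‖ ^ 2 := by
          rw [← mul_pow]
          gcongr
          exact norm_inner_le_norm x k
        rw [inner_rankOne_self, smul_apply, one_apply_eq_self, inner_smul_right]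
        change (Complex.ofReal _).re ≤ (Complex.ofReal _ * inner ℂ k k).re
        rw [Complex.ofReal_re, Complex.re_ofReal_mul]
        exact h1.trans_eq (congrArg _ (inner_self_eq_norm_sq (𝕜 := ℂ) k).symm)
    have h2 := map_mono Z h1
    have h0 : 0 ≤ Z (rankOne ℂ x x) := by
      have := map_mono Z ((ContinuousLinearMap.nonneg_iff_isPositive _).2
        (InnerProductSpace.isPositive_rankOne_self (𝕜 := ℂ) x))
      rwa [map_zero] at this
    rw [map_smul, hZ] at h2
    refine (CStarAlgebra.norm_le_norm_of_nonneg_of_le h0 h2).trans ?_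
    rw [norm_smul]
    have h3 : ‖(1 : H →L[ℂ] H)‖ ≤ 1 := ContinuousLinearMap.norm_id_le
    calc ‖((‖x‖ ^ 2 : ℝ) : ℂ)‖ * ‖(1 : H →L[ℂ] H)‖ ≤ ‖((‖x‖ ^ 2 : ℝ) : ℂ)‖ * 1 := by gcongr
      _ = ‖x‖ ^ 2 := by simp

end CPMap

theorem HilbertBasis.hasSum_norm_inner_sq {ι E : Type*} [NormedAddCommGroup E]
    [InnerProductSpace ℂ E] (b : HilbertBasis ι ℂ E) (x : E) :
    HasSum (fun i => ‖inner ℂ (b i) x‖ ^ 2) (‖x‖ ^ 2) := by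
  have h1 := Complex.hasSum_re (b.hasSum_inner_mul_inner x x)
  have h2 : (inner ℂ x x : ℂ).re = ‖x‖ ^ 2 := inner_self_eq_norm_sq (𝕜 := ℂ) x
  rw [h2] at h1
  refine h1.congr_fun fun i => ?_
  rw [← inner_conj_symm x, RCLike.conj_mul]
  norm_cast

namespace CPMap

open InnerProductSpace (rankOne)

variable {H : Type u} [NormedAddCommGroup H] [InnerProductSpace ℂ H] [CompleteSpace H]

theorem isSelfAdjoint_sum_rankOne {κ : Type*} (F : Finset κ) (x : κ → H) :
    IsSelfAdjoint (∑ j ∈ F, rankOne ℂ (x j) (x j)) := by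
  rw [IsSelfAdjoint, star_sum]
  exact Finset.sum_congr rfl fun j _ => isSelfAdjoint_rankOne (x j)

/-- The identity is the least upper bound of the finite sums of the rank one projections of an
orthonormal basis. -/
theorem isLUB_sum_rankOne {κ : Type*} (c : HilbertBasis κ ℂ H) :
    IsLUB (Set.range fun F : Finset κ => ∑ j ∈ F, rankOne ℂ (c j) (c j)) (1 : H →L[ℂ] H) := by
  constructor
  · rintro _ ⟨F, rfl⟩
    refine le_of_re_inner_le (isSelfAdjoint_sum_rankOne F _) (IsSelfAdjoint.one _) fun k => ?_
    rw [re_inner_sum_rankOne, one_apply_eq_self, inner_self_eq_norm_sq]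
    exact sum_le_hasSum F (fun _ _ => sq_nonneg _) (c.hasSum_norm_inner_sq k)
  · intro y hy
    have hy0 : 0 ≤ y := by simpa using hy ⟨∅, rfl⟩
    refine le_of_re_inner_le (IsSelfAdjoint.one _) (IsSelfAdjoint.of_nonneg hy0) fun k => ?_
    rw [one_apply_eq_self, inner_self_eq_norm_sq]
    refine hasSum_le_of_sum_le (c.hasSum_norm_inner_sq k) fun F => ?_
    rw [← re_inner_sum_rankOne]
    exact re_inner_le_of_le (hy ⟨F, rfl⟩) k

/-- `∑_i A_i |x⟩⟨x| A_i^* = Z(|x⟩⟨x|)`, as quadratic forms. -/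
def RepresentsRankOne {ι : Type*} (T : ι → H →L[ℂ] H) (Z : (H →L[ℂ] H) →CP (H →L[ℂ] H)) : Prop :=
  ∀ x k, HasSum (fun i => ‖inner ℂ x (adjoint (T i) k)‖ ^ 2)
    (RCLike.re (inner ℂ k (Z (rankOne ℂ x x) k)))

section Represents

variable {ι : Type*} {T : ι → H →L[ℂ] H} {Z : (H →L[ℂ] H) →CP (H →L[ℂ] H)}

theorem RepresentsRankOne.hasSum_sum (hT : RepresentsRankOne T Z) {κ : Type*} (F : Finset κ)
    (x : κ → H) (k : H) :
    HasSum (fun i => ∑ j ∈ F, ‖inner ℂ (x j) (adjoint (T i) k)‖ ^ 2)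
      (RCLike.re (inner ℂ k (Z (∑ j ∈ F, rankOne ℂ (x j) (x j)) k))) := by
  have h1 := _root_.hasSum_sum (s := F) fun j _ => hT (x j) k
  rw [map_sum, sum_apply, inner_sum, map_sum]
  exact h1

/-- The sums `∑ A_i s² A_i^*` are at most `Z(s²)`: approximate `s²` from below by the finite rank
operators `s p s`. -/
theorem RepresentsRankOne.sum_norm_sq_le (hT : RepresentsRankOne T Z) {s : H →L[ℂ] H}
    (hs : IsSelfAdjoint s) (t : Finset ι) (k : H) :
    ∑ i ∈ t, ‖s (adjoint (T i) k)‖ ^ 2 ≤ RCLike.re (inner ℂ k (Z (s * s) k)) := by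
  obtain ⟨κ, c, -⟩ := exists_hilbertBasis ℂ H
  have hsym : ∀ x y, inner ℂ (s x) y = inner ℂ x (s y) := fun x y => by
    rw [← ContinuousLinearMap.adjoint_inner_right]
    exact congrArg (fun r : H →L[ℂ] H => inner ℂ x (r y)) hs
  refine hasSum_le_of_sum_le (_root_.hasSum_sum (s := t) fun i _ =>
    c.hasSum_norm_inner_sq (s (adjoint (T i) k))) fun F => ?_
  rw [Finset.sum_comm]
  have h1 := hT.hasSum_sum F (fun j => s (c j)) k
  simp only [hsym] at h1
  refine (sum_le_hasSum t (fun i _ => Finset.sum_nonneg fun j _ => sq_nonneg _) h1).trans ?_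
  refine re_inner_le_of_le (map_mono Z ?_) k
  refine le_of_re_inner_le (isSelfAdjoint_sum_rankOne F _) ?_ fun h => ?_
  · rw [IsSelfAdjoint, star_mul, hs.star_eq]
  · rw [re_inner_sum_rankOne]
    simp only [hsym]
    change _ ≤ RCLike.re (inner ℂ h (s (s h)))
    rw [← hsym, inner_self_eq_norm_sq]
    exact sum_le_hasSum F (fun _ _ => sq_nonneg _) (c.hasSum_norm_inner_sq (s h))

theorem RepresentsRankOne.sum_re_inner_le (hT : RepresentsRankOne T Z) {x : H →L[ℂ] H}
    (hx : 0 ≤ x) (t : Finset ι) (k : H) :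
    ∑ i ∈ t, RCLike.re (inner ℂ (adjoint (T i) k) (x (adjoint (T i) k))) ≤
      RCLike.re (inner ℂ k (Z x k)) := by
  have hs : IsSelfAdjoint (CFC.sqrt x) := IsSelfAdjoint.of_nonneg (CFC.sqrt_nonneg x)
  have hsx : CFC.sqrt x * CFC.sqrt x = x := CFC.sqrt_mul_sqrt_self x hx
  have h1 := hT.sum_norm_sq_le hs t k
  rw [hsx] at h1
  refine le_trans (Finset.sum_le_sum fun i _ => le_of_eq ?_) h1
  generalize adjoint (T i) k = h
  have h2 : x h = CFC.sqrt x (CFC.sqrt x h) := (DFunLike.congr_fun hsx h).symm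
  have h3 : adjoint (CFC.sqrt x) = CFC.sqrt x := hs
  rw [← inner_self_eq_norm_sq (𝕜 := ℂ), ← ContinuousLinearMap.adjoint_inner_right, h3, h2]

/-- The tuple of a unital map, as a row contraction. -/
noncomputable def RepresentsRankOne.toRowContraction (hT : RepresentsRankOne T Z) (hZ : Z 1 = 1) :
    RowContraction ι H where
  op := T
  sum_le_one s := RowContraction.sum_comp_adjoint_le_one T s fun h => by
    have h1 := hT.sum_norm_sq_le (IsSelfAdjoint.one _) s h
    simpa only [one_apply_eq_self, mul_one, hZ, inner_self_eq_norm_sq] using h1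

/-- Normality, applied to the net of finite rank projections, gives `∑ A_i A_i^* = 1`. -/
theorem RepresentsRankOne.hasSum_norm_sq (hT : RepresentsRankOne T Z) (hZ : Z 1 = 1)
    (hn : ScottContinuous Z) (k : H) :
    HasSum (fun i => ‖adjoint (T i) k‖ ^ 2) (‖k‖ ^ 2) := by
  classical
  set A := hT.toRowContraction hZ
  have hcol : ∀ k, HasSum (fun i => ‖adjoint (T i) k‖ ^ 2) (‖A.column k‖ ^ 2) := by
    intro k
    have h1 := lp.hasSum_norm (p := 2) (by norm_num) (A.column k)
    simpa using! h1
  obtain ⟨κ, c, -⟩ := exists_hilbertBasis ℂ H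
  have hmono : Monotone fun F : Finset κ => ∑ j ∈ F, rankOne ℂ (c j) (c j) := by
    intro F G hFG
    refine le_of_re_inner_le (isSelfAdjoint_sum_rankOne F _) (isSelfAdjoint_sum_rankOne G _)
      fun k => ?_
    rw [re_inner_sum_rankOne, re_inner_sum_rankOne]
    exact Finset.sum_le_sum_of_subset_of_nonneg hFG fun _ _ _ => sq_nonneg _
  have hLUB := hn (Set.range_nonempty _) (directedOn_range.2 hmono.directed_le)
    (isLUB_sum_rankOne c)
  have hle : Z 1 ≤ adjoint A.column ∘L A.column := by
    refine hLUB.2 ?_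
    rintro _ ⟨_, ⟨F, rfl⟩, rfl⟩
    refine le_of_re_inner_le ?_ ?_ fun k => ?_
    · rw [IsSelfAdjoint, ← map_star, (isSelfAdjoint_sum_rankOne F _).star_eq]
    · rw [IsSelfAdjoint, ContinuousLinearMap.star_eq_adjoint, ContinuousLinearMap.adjoint_comp,
        ContinuousLinearMap.adjoint_adjoint]
    · rw [ContinuousLinearMap.comp_apply, ContinuousLinearMap.adjoint_inner_right,
        inner_self_eq_norm_sq]
      exact hasSum_le (fun i => sum_le_hasSum F (fun _ _ => sq_nonneg _)
        (c.hasSum_norm_inner_sq _)) (hT.hasSum_sum F _ k) (hcol k)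
  have h1 := re_inner_le_of_le hle k
  rw [hZ, one_apply_eq_self, inner_self_eq_norm_sq, ContinuousLinearMap.comp_apply,
    ContinuousLinearMap.adjoint_inner_right, inner_self_eq_norm_sq] at h1
  have h2 : ‖A.column k‖ ^ 2 ≤ ‖k‖ ^ 2 := by
    have h3 : ‖A.column k‖ ≤ ‖k‖ := by
      simpa using A.column.le_of_opNorm_le A.norm_column_le k
    gcongr
  rw [← le_antisymm h2 h1]
  exact hcol k

/-- For `0 ≤ x ≤ r`, the lower bounds for `Z(x)` and `Z(r - x)` add up to an equality. -/
theorem RepresentsRankOne.hasSum_inner (hT : RepresentsRankOne T Z) (hZ : Z 1 = 1)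
    (hn : ScottContinuous Z) {x : H →L[ℂ] H} (hx : 0 ≤ x) (k : H) :
    HasSum (fun i => inner ℂ (adjoint (T i) k) (x (adjoint (T i) k))) (inner ℂ k (Z x k)) := by
  have hreal : ∀ {y : H →L[ℂ] H}, 0 ≤ y → ∀ h, inner ℂ h (y h) =
      ((RCLike.re (inner ℂ h (y h)) : ℝ) : ℂ) := by
    intro y hy h
    have h1 := ((ContinuousLinearMap.isPositive_iff_complex y).1
      ((ContinuousLinearMap.nonneg_iff_isPositive y).1 hy) h).1
    rw [← inner_conj_symm h (y h), ← h1]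
    exact (Complex.conj_ofReal _).trans (by rw [RCLike.conj_re]; rfl)
  have hZx : 0 ≤ Z x := by simpa only [map_zero] using map_mono Z hx
  set r : ℝ := ‖x‖ with hr
  have hrx : 0 ≤ (r : ℂ) • (1 : H →L[ℂ] H) - x := by
    rw [sub_nonneg]
    refine le_of_re_inner_le (IsSelfAdjoint.of_nonneg hx) ?_ fun h => ?_
    · rw [IsSelfAdjoint, star_smul, star_one]
      simp
    · rw [smul_apply, one_apply_eq_self, inner_smul_right]
      refine (RCLike.re_le_norm _).trans ((norm_inner_le_norm _ _).trans ?_)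
      change _ ≤ (Complex.ofReal _ * inner ℂ h h).re
      rw [Complex.re_ofReal_mul]
      have h1 : (inner ℂ h h : ℂ).re = ‖h‖ ^ 2 := inner_self_eq_norm_sq (𝕜 := ℂ) h
      rw [h1]
      nlinarith [x.le_opNorm h, norm_nonneg h]
  have hnonneg : ∀ {y : H →L[ℂ] H}, 0 ≤ y → ∀ h, 0 ≤ RCLike.re (inner ℂ h (y h)) :=
    fun hy h => ((ContinuousLinearMap.nonneg_iff_isPositive _).1 hy).re_inner_nonneg_right h
  have hle1 := hT.sum_re_inner_le hx (k := k)
  have hle2 := hT.sum_re_inner_le hrx (k := k)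
  have hs1 := (summable_of_sum_le (fun i => hnonneg hx _) hle1).hasSum
  have hs2 := (summable_of_sum_le (fun i => hnonneg hrx _) hle2).hasSum
  have hb1 := hasSum_le_of_sum_le hs1 hle1
  have hb2 := hasSum_le_of_sum_le hs2 hle2
  have hsplit : ∀ (y : H →L[ℂ] H) (h : H),
      RCLike.re (inner ℂ h (((r : ℂ) • (1 : H →L[ℂ] H) - y) h)) =
        r * ‖h‖ ^ 2 - RCLike.re (inner ℂ h (y h)) := by
    intro y h
    rw [sub_apply, inner_sub_right, map_sub, smul_apply, one_apply_eq_self, inner_smul_right]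
    congr 1
    change (Complex.ofReal _ * inner ℂ h h).re = _
    rw [Complex.re_ofReal_mul]
    exact congrArg _ (inner_self_eq_norm_sq (𝕜 := ℂ) h)
  have hsum := hs1.add hs2
  simp only [hsplit, add_sub_cancel] at hsum
  have htot := hsum.unique ((hT.hasSum_norm_sq hZ hn k).mul_left r)
  rw [map_sub, map_smul, hZ, hsplit] at hb2
  have heq : ∑' i, RCLike.re (inner ℂ (adjoint (T i) k) (x (adjoint (T i) k))) =
      RCLike.re (inner ℂ k (Z x k)) := by
    refine le_antisymm hb1 ?_
    simp only [hsplit] at hb2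
    linarith
  rw [heq] at hs1
  have h1 := Complex.hasSum_ofReal.2 hs1
  rw [hreal hZx]
  exact h1.congr_fun fun i => hreal hx _

theorem RepresentsRankOne.hasSum_apply (hT : RepresentsRankOne T Z) (hZ : Z 1 = 1)
    (hn : ScottContinuous Z) (x : H →L[ℂ] H) (h : H) :
    HasSum (fun i => T i (x (adjoint (T i) h))) (Z x h) := by
  classical
  have hx : x ∈ Submodule.span ℂ {a : H →L[ℂ] H | 0 ≤ a} := by
    rw [CStarAlgebra.span_nonneg]
    trivial
  induction hx using Submodule.span_induction with
  | zero => simp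
  | add x y _ _ hx hy => simpa only [map_add, add_apply] using hx.add hy
  | smul a x _ hx => simpa only [map_smul, smul_apply] using hx.const_smul a
  | mem x hx =>
    set A := hT.toRowContraction hZ
    have hmem : ∀ k, Memℓp (fun i => x (adjoint (T i) k)) 2 := fun k =>
      ((lp.memℓp (A.column k)).norm.const_mul ‖x‖).mono fun i => x.le_opNorm _
    let z : H →ₗ[ℂ] H :=
      { toFun := fun k => A.row ⟨fun i => x (adjoint (T i) k), hmem k⟩
        map_add' := fun k l => by
          rw [← map_add]
          congr 1
          ext i
          change x (adjoint (T i) (k + l)) = x (adjoint (T i) k) + x (adjoint (T i) l)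
          rw [map_add, map_add]
        map_smul' := fun a k => by
          rw [RingHom.id_apply, ← map_smul]
          congr 1
          ext i
          change x (adjoint (T i) (a • k)) = a • x (adjoint (T i) k)
          rw [map_smul, map_smul] }
    have hz : ∀ k, HasSum (fun i => T i (x (adjoint (T i) k))) (z k) := by
      intro k
      have h1 := (lp.hasSum_single (E := fun _ : ι => H) (p := 2) (by simp)
        ⟨fun i => x (adjoint (T i) k), hmem k⟩).mapL A.row
      refine h1.congr_fun fun i => ?_
      rw [A.row_single]
      rfl
    have hzZ : z = (Z x).toLinearMap := by
      refine (ext_inner_map _ _).1 fun k => ?_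
      have h1 := (hz k).mapL (innerSL ℂ k)
      have h2 := hT.hasSum_inner hZ hn hx k
      have h3 : inner ℂ k (z k) = inner ℂ k (Z x k) := by
        refine (h1.congr_fun fun i => ?_).unique h2
        rw [innerSL_apply_apply, ContinuousLinearMap.adjoint_inner_left]
      rw [← inner_conj_symm (z k), h3, inner_conj_symm]
      rfl
    have h1 := hz h
    rw [hzZ] at h1
    exact h1

end Represents

/-- A normal unital completely positive map has a minimal Kraus decomposition: the elements of an
orthonormal basis of the reproducing kernel Hilbert space of the kernel `Z(|x⟩⟨y|)`, which are
operators on `H`. -/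
theorem exists_isMinimalKraus (Z : (H →L[ℂ] H) →CP (H →L[ℂ] H)) (hZ : Z 1 = 1)
    (hn : ScottContinuous Z) {e : H} (he : ‖e‖ = 1) :
    ∃ (ι : Type u) (A : RowContraction ι H), A.IsMinimalKraus Z := by
  have : Fact (choiKernel Z).PosSemidef := ⟨posSemidef_choiKernel Z he⟩
  obtain ⟨ι, b, -⟩ := exists_hilbertBasis ℂ (RKHS.OfKernel (choiKernel Z))
  choose T hTb using fun i => exists_clm_of_rkhs Z hZ (b i)
  have hT : RepresentsRankOne T Z := by
    intro x k
    have h1 := b.hasSum_norm_inner_sq (RKHS.kerFun (RKHS.OfKernel (choiKernel Z)) x k)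
    have h2 : ‖RKHS.kerFun (RKHS.OfKernel (choiKernel Z)) x k‖ ^ 2 =
        RCLike.re (inner ℂ k (Z (rankOne ℂ x x) k)) := by
      rw [← inner_self_eq_norm_sq (𝕜 := ℂ), ← RKHS.kernel_inner, RKHS.OfKernel.kernel_ofKernel,
        choiKernel_apply, inner_re_symm]
    rw [h2] at h1
    refine h1.congr_fun fun i => ?_
    rw [RKHS.inner_kerFun, ← hTb, ContinuousLinearMap.adjoint_inner_right]
  refine ⟨ι, hT.toRowContraction hZ, hT.hasSum_apply hZ hn, fun c hc => ?_⟩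
  -- A vanishing combination `∑ c_i A_i` is the zero function in the reproducing kernel space.
  have h1 : b.repr.symm c = 0 := by
    refine RKHS.ext fun h => ?_
    have h2 := (b.hasSum_repr_symm c).mapL
      (ContinuousLinearMap.proj h ∘L RKHS.coeCLM (H := RKHS.OfKernel (choiKernel Z)) ℂ)
    rw [RKHS.coe_zero, Pi.zero_apply]
    refine h2.unique ((hc h).congr_fun fun i => ?_)
    change RKHS.coeCLM ℂ (c i • b i) h = c i • T i h
    rw [hTb, map_smul]
    rfl
  rwa [LinearIsometryEquiv.map_eq_zero_iff] at h1

end CPMap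

theorem theorem3p6p1 {H₁ : Type u} {H₂ : Type v}
    [NormedAddCommGroup H₁] [InnerProductSpace ℂ H₁] [CompleteSpace H₁]
    [NormedAddCommGroup H₂] [InnerProductSpace ℂ H₂] [CompleteSpace H₂]
    (Ω₁ : H₁) (Ω₂ : H₂) (hΩ₁ : ‖Ω₁‖ = 1) (hΩ₂ : ‖Ω₂‖ = 1) :
    -- classification of row contractions
    (∀ (ι : Type w) (ω : ι → ℂ) (hω : HasSum (fun i => ‖ω i‖ ^ 2) 1)
      (A : RowContraction ι H₁) (B : RowContraction ι H₂),
      A.IsCoisometric → A.IsErgodic → A.HasAdjointEigenvector Ω₁ ω →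
      B.IsCoisometric → B.IsErgodic → B.HasAdjointEigenvector Ω₂ ω →
        A.HasExtChar Ω₁ ω hω ∧ B.HasExtChar Ω₂ ω hω ∧
          (A.ExtCharEquivalent Ω₁ B Ω₂ ω hω ↔ A.UnitarilyEquivalent B)) ∧
    -- classification of completely positive maps
    (∀ (Z₁ : (H₁ →L[ℂ] H₁) →CP (H₁ →L[ℂ] H₁)) (Z₂ : (H₂ →L[ℂ] H₂) →CP (H₂ →L[ℂ] H₂)),
      CPMap.IsNormalUnitalErgodic Z₁ Ω₁ → CPMap.IsNormalUnitalErgodic Z₂ Ω₂ →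
        (CPMap.ExtCharEquivalent Z₁ Ω₁ Z₂ Ω₂ ↔ CPMap.Conjugate Z₁ Z₂) ∧
        -- it does not matter which minimal Kraus decomposition of `Z₁` is chosen
        ∀ (ι : Type w) (A : RowContraction ι H₁), A.IsMinimalKraus Z₁ →
          ∃ (ω : ι → ℂ) (hω : HasSum (fun i => ‖ω i‖ ^ 2) 1), A.HasAdjointEigenvector Ω₁ ω ∧
            ((∃ B : RowContraction ι H₂, B.IsMinimalKraus Z₂ ∧ B.HasAdjointEigenvector Ω₂ ω ∧
                A.ExtCharEquivalent Ω₁ B Ω₂ ω hω) ↔ CPMap.Conjugate Z₁ Z₂)) := by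
  refine ⟨fun ι ω hω A B hAc hA hAω hBc hB hBω => ⟨hAω.hasExtChar hAc hA hω hΩ₁,
    hBω.hasExtChar hBc hB hω hΩ₂,
    RowContraction.extCharEquivalent_iff hω hΩ₁ hΩ₂ hAc hA hAω hBc hB hBω⟩,
    fun Z₁ Z₂ hZ₁ hZ₂ => ⟨⟨?_, fun hconj => ?_⟩, fun ι A hA =>
      hA.exists_extCharEquivalent_iff hΩ₁ hΩ₂ hZ₁ hZ₂⟩⟩
  · rintro ⟨ι, ω, hω, A, B, hA, hB, hAω, hBω, hAB⟩
    exact hA.conjugate hB ((RowContraction.extCharEquivalent_iff hω hΩ₁ hΩ₂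
      (hA.isCoisometric hZ₁.unital) (hA.isErgodic hZ₁.ergodic) hAω
      (hB.isCoisometric hZ₂.unital) (hB.isErgodic hZ₂.ergodic) hBω).1 hAB)
  · obtain ⟨ι, A, hA⟩ := CPMap.exists_isMinimalKraus Z₁ hZ₁.unital hZ₁.normal hΩ₁
    obtain ⟨ω, hω, hAω, hiff⟩ := hA.exists_extCharEquivalent_iff hΩ₁ hΩ₂ hZ₁ hZ₂
    obtain ⟨B, hB, hBω, hAB⟩ := hiff.2 hconj
    exact ⟨ι, ω, hω, A, B, hA, hB, hAω, hBω, hAB⟩
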